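/- Let $n\ge 1$ and let $a,b,c\in C^\infty(\mathbb R^n)$ satisfy, for some real exponents $\alpha,\beta,\gamma$ and positive constants $a_i,b_i,c_i$ ($i=0,1$) and all $x\in\mathbb R^n$, $$a_0(1+|x|)^{-\alpha}\le a(x)\le a_1(1+|x|)^{-\alpha},\quad b_0(1+|x|)^{\beta}\le b(x)\le b_1(1+|x|)^{\beta},\quad c_0(1+|x|)^{-\gamma}\le c(x)\le c_1(1+|x|)^{-\gamma}.$$ Let $q\in C^1([0,\infty))$ satisfy $0<q'(|x|)\le\sqrt{c(x)/b(x)}$ for all $x\in\mathbb R^n$, let $R\ge 0$, and let $h\in C((0,\infty),L^2(\mathbb R^n))$ be such that, for every $t>0$, $h(x,t)=0$ for almost every $x$ with $q(|x|)>t+q(R)$. Let $(u_0,u_1)\in H^1(\mathbb R^n)\times L^2(\mathbb R^n)$, and let $u\in C((0,\infty),H^1(\mathbb R^n))\cap C^1((0,\infty),L^2(\mathbb R^n))$ be a weak (distributional) solution of $$c(x)u_{tt}-\operatorname{div}(b(x)\nabla u)+a(x)u_t=h,\qquad x\in\mathbb R^n,\ t>0,$$ with data $(u,u_t)|_{t=0}=(u_0,u_1)$,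 i.e. $u(t)\to u_0$ in $H^1(\mathbb R^n)$ and $u_t(t)\to u_1$ in $L^2(\mathbb R^n)$ as $t\to 0^+$. In the case $\beta+\gamma>2$ (and only then) the solution is moreover understood to have locally bounded energy in the exterior region: for every $T>0$, $$\sup_{0<t\le T}\int_{q(|x|)>t+q(R)}\left(c(x)u_t^2+b(x)|\nabla u|^2\right)dx<\infty.$$ If $u_0(x)=u_1(x)=0$ for almost every $x$ with $|x|>R$, then for every $t>0$ one has $u(x,t)=0$ for almost every $x$ with $q(|x|)>t+q(R)$. -/

import Mathlib

open MeasureTheory Set Filter Topology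
open scoped ContDiff NNReal ENNReal

noncomputable section

namespace DampedWave

/-- Euclidean space `ℝⁿ`. -/
abbrev E (n : ℕ) : Type := EuclideanSpace ℝ (Fin n)

/-- `L²(ℝⁿ)`, real valued. -/
abbrev L2 (n : ℕ) : Type := Lp ℝ 2 (volume : Measure (E n))

/-- `L²(ℝⁿ; ℝⁿ)`, square integrable vector fields. -/
abbrev L2V (n : ℕ) : Type := Lp (E n) 2 (volume : Measure (E n))

/-- Test functions `φ ∈ C_c^∞(ℝⁿ)`. -/
def IsTestFunction {n : ℕ} (φ : E n → ℝ) : Prop :=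
  ContDiff ℝ ∞ φ ∧ HasCompactSupport φ

/-- `G` is the weak gradient of `f`: for every test function `φ` and every direction `e`,
`∫ f ∂ₑφ = - ∫ (G · e) φ`. -/
def IsWeakGradient {n : ℕ} (f : L2 n) (G : L2V n) : Prop :=
  ∀ φ : E n → ℝ, IsTestFunction φ → ∀ e : E n,
    ∫ x, f x * fderiv ℝ φ x e = - ∫ x, inner ℝ (G x) e * φ x

theorem IsTestFunction.memLp {n : ℕ} {φ : E n → ℝ} (hφ : IsTestFunction φ) :
    MemLp φ 2 (volume : Measure (E n)) :=
  hφ.1.continuous.memLp_of_hasCompactSupport hφ.2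

theorem IsTestFunction.memLp_fderiv {n : ℕ} {φ : E n → ℝ} (hφ : IsTestFunction φ) (e : E n) :
    MemLp (fun x => fderiv ℝ φ x e) 2 (volume : Measure (E n)) := by
  have h1 : Continuous (fun x => fderiv ℝ φ x e) :=
    (hφ.1.continuous_fderiv (by simp)).clm_apply continuous_const
  exact h1.memLp_of_hasCompactSupport (hφ.2.fderiv_apply (𝕜 := ℝ) e)

/-- The Sobolev space `H¹(ℝⁿ)`, realised as the space of pairs `(f, ∇f)` in `L² × L²` where
`∇f` is the weak gradient of `f`.  The norm inherited from `L² × L²` is equivalent to the usual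
`H¹` norm, so convergence and continuity have their usual meaning. -/
def H1 (n : ℕ) : Submodule ℝ (L2 n × L2V n) where
  carrier := {p | IsWeakGradient p.1 p.2}
  zero_mem' := by
    intro φ _ e
    have h1 : (fun x => (0 : L2 n) x * fderiv ℝ φ x e) =ᵐ[volume] fun _ => (0 : ℝ) := by
      filter_upwards [Lp.coeFn_zero ℝ 2 (volume : Measure (E n))] with x hx
      simp
    have h2 : (fun x => inner ℝ ((0 : L2V n) x) e * φ x) =ᵐ[volume] fun _ => (0 : ℝ) := by
      filter_upwards [Lp.coeFn_zero (E n) 2 (volume : Measure (E n))] with x hx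
      simp
    change ∫ x, (0 : L2 n) x * fderiv ℝ φ x e = - ∫ x, inner ℝ ((0 : L2V n) x) e * φ x
    rw [integral_congr_ae h1, integral_congr_ae h2]
    simp
  add_mem' := by
    rintro ⟨f, F⟩ ⟨g, G⟩ hf hg φ hφ e
    have hf' := hf φ hφ e
    have hg' := hg φ hφ e
    have i1 := (Lp.memLp f).integrable_mul (hφ.memLp_fderiv e)
    have i2 := (Lp.memLp g).integrable_mul (hφ.memLp_fderiv e)
    have i3 := ((Lp.memLp F).inner_const (𝕜 := ℝ) e).integrable_mul hφ.memLp
    have i4 := ((Lp.memLp G).inner_const (𝕜 := ℝ) e).integrable_mul hφ.memLp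
    have h1 : (fun x => (f + g) x * fderiv ℝ φ x e) =ᵐ[volume]
        fun x => f x * fderiv ℝ φ x e + g x * fderiv ℝ φ x e := by
      filter_upwards [Lp.coeFn_add f g] with x hx
      rw [hx, Pi.add_apply, add_mul]
    have h2 : (fun x => inner ℝ ((F + G) x) e * φ x) =ᵐ[volume]
        fun x => inner ℝ (F x) e * φ x + inner ℝ (G x) e * φ x := by
      filter_upwards [Lp.coeFn_add F G] with x hx
      rw [hx, Pi.add_apply, inner_add_left, add_mul]
    change ∫ x, (f + g) x * fderiv ℝ φ x e = - ∫ x, inner ℝ ((F + G) x) e * φ x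
    rw [integral_congr_ae h1, integral_congr_ae h2]
    have s1 : ∫ x, (f x * fderiv ℝ φ x e + g x * fderiv ℝ φ x e) =
        (∫ x, f x * fderiv ℝ φ x e) + ∫ x, g x * fderiv ℝ φ x e := integral_add i1 i2
    have s2 : ∫ x, (inner ℝ (F x) e * φ x + inner ℝ (G x) e * φ x) =
        (∫ x, inner ℝ (F x) e * φ x) + ∫ x, inner ℝ (G x) e * φ x := integral_add i3 i4
    simp only at hf' hg'
    rw [s1, s2, hf', hg']
    ring
  smul_mem' := by
    rintro r ⟨f, F⟩ hf φ hφ e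
    have hf' := hf φ hφ e
    have h1 : (fun x => (r • f) x * fderiv ℝ φ x e) =ᵐ[volume]
        fun x => r * (f x * fderiv ℝ φ x e) := by
      filter_upwards [Lp.coeFn_smul r f] with x hx
      rw [hx, Pi.smul_apply, smul_eq_mul, mul_assoc]
    have h2 : (fun x => inner ℝ ((r • F) x) e * φ x) =ᵐ[volume]
        fun x => r * (inner ℝ (F x) e * φ x) := by
      filter_upwards [Lp.coeFn_smul r F] with x hx
      rw [hx, Pi.smul_apply, real_inner_smul_left, mul_assoc]
    change ∫ x, (r • f) x * fderiv ℝ φ x e = - ∫ x, inner ℝ ((r • F) x) e * φ x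
    rw [integral_congr_ae h1, integral_congr_ae h2, integral_const_mul, integral_const_mul]
    simp only at hf'
    rw [hf']
    ring

/-- The `L²` function underlying an element of `H¹`. -/
def toL2 {n : ℕ} (f : H1 n) : L2 n := f.1.1

/-- The weak gradient of an element of `H¹`. -/
def grad {n : ℕ} (f : H1 n) : L2V n := f.1.2

/-- The time derivative `u_t`, taken in `L²(ℝⁿ)`. -/
def timeDeriv {n : ℕ} (u : ℝ → H1 n) (t : ℝ) : L2 n := deriv (fun s => toL2 (u s)) t

/-- Two-sided power bound
`f₀ (1 + |x|)^κ ≤ f(x) ≤ f₁ (1 + |x|)^κ` with positive constants `f₀`, `f₁`. -/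
def HasPowerGrowth {n : ℕ} (f : E n → ℝ) (κ : ℝ) : Prop :=
  ∃ f₀ f₁ : ℝ, 0 < f₀ ∧ 0 < f₁ ∧
    ∀ x : E n, f₀ * (1 + ‖x‖) ^ κ ≤ f x ∧ f x ≤ f₁ * (1 + ‖x‖) ^ κ

/-- `u` is a (weak) solution of `c u_tt - div (b ∇u) + a u_t = h` on `ℝⁿ × (0, ∞)` with data
`(u, u_t)|_{t = 0} = (u₀, u₁)`.  Only the values `u t`, `h t` with `t > 0` are relevant.
As `u_t`, `∇u` and `h` are continuous in time with values in `L²`, the field `equation`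
is the equation in the sense of distributions on `ℝⁿ × (0, ∞)`; note that
`fderiv ℝ φ x (∇u(x, t)) = ∇u(x, t) · ∇φ(x)`. -/
structure IsSolution {n : ℕ} (a b c : E n → ℝ) (h : ℝ → L2 n) (u₀ : H1 n) (u₁ : L2 n)
    (u : ℝ → H1 n) : Prop where
  /-- `u ∈ C((0, ∞), H¹)` -/
  continuousOn : ContinuousOn u (Ioi 0)
  /-- `u ∈ C¹((0, ∞), L²)` -/
  contDiffOn : ContDiffOn ℝ 1 (fun t => toL2 (u t)) (Ioi 0)
  /-- the equation, tested against `φ ∈ C_c^∞(ℝⁿ)` -/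
  equation : ∀ φ : E n → ℝ, IsTestFunction φ → ∀ t : ℝ, 0 < t →
    HasDerivAt (fun s => ∫ x, c x * timeDeriv u s x * φ x)
      ((∫ x, h t x * φ x) - (∫ x, b x * fderiv ℝ φ x (grad (u t) x))
        - ∫ x, a x * timeDeriv u t x * φ x) t
  /-- `u|_{t = 0} = u₀` in `H¹` -/
  initial : Tendsto u (𝓝[>] 0) (𝓝 u₀)
  /-- `u_t|_{t = 0} = u₁` in `L²` -/
  initial_deriv : Tendsto (timeDeriv u) (𝓝[>] 0) (𝓝 u₁)

/-- The exterior region `{x : q(|x|) > t + q(R)}` at time `t`. -/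
def exterior (n : ℕ) (q : ℝ → ℝ) (R t : ℝ) : Set (E n) := {x | t + q R < q ‖x‖}

/-- The energy `∫_S (c u_t² + b |∇u|²) dx` in `S`, as an element of `[0, ∞]` (for `b, c ≥ 0`). -/
def energyOn {n : ℕ} (b c : E n → ℝ) (u : ℝ → H1 n) (S : Set (E n)) (t : ℝ) : ℝ≥0∞ :=
  ∫⁻ x in S, ENNReal.ofReal (c x * (timeDeriv u t x) ^ 2 + b x * ‖grad (u t) x‖ ^ 2)

end DampedWave

end

noncomputable section

namespace DampedWave

open scoped BoundedContinuousFunction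

variable {n : ℕ}

/-! The classical energy argument multiplies the equation by `u_t` over a region bounded by a
characteristic-type surface. Here `u_t` is only `L²` in space and so is not an admissible test
function. The proof therefore integrates the equation once in time. With `V = ∫₀ᵗ ∇u ds`, the
vanishing of the source and of the data in the exterior region gives `c u_t - div (b V) + a u = 0`
weakly there (`IsSolution.integrated_equation`). This may be tested against `σ u`, because `u(t) ∈
H¹` (`pairing_sobolev`). The resulting energy is `∫ σ (c u² + b |V|²)`, which starts from zero.

The cutoff `σ` is a product of two smooth steps. The inner one, `χ(q(|x|) - t - A)` with `A = q(R) +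
δ`, moves outward. Its flux is dominated by its loss in time, since `b q'² ≤ c` is the statement
that signals do not outrun the front; the damping term also has a good sign. Only the flux through
the outer step `χ(2 - εKt - ε log(1 + |x|²))` remains (`exists_hasDerivAt_localEnergy`). The
logarithm gives this step a gradient of size `ε |x| / (1 + |x|²)`, so both the small factor `ε` and
a gain of one power of `|x|` are available.

If `β + γ ≤ 2`, the local speed `√(b/c)` grows at most linearly, and the outer front can be made to
recede faster than signals travel: for `K` large the outer flux is nonpositive (`outerFlux_nonpos`),
and no integrability at infinity is needed.

If `β + γ > 2`, take `K = 0` and show that the outer flux is `O(ε)`. The energy hypothesis controls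
`∫ b |V|²` in the exterior through Minkowski's inequality in time, and controls `∫ b |x|² (1 +
|x|²)⁻² u²` through a weighted Hardy inequality (`hardy_truncated`, `exists_weighted_bound`).

In both cases `ε → 0` forces `u` to vanish where `q(|x|) > t + q(R) + δ`, and `δ → 0` concludes. -/

/-! ### Mollification -/

/-- `G` is the weak gradient of the function `f`. -/
def HasWeakGradient (f : E n → ℝ) (G : E n → E n) : Prop :=
  ∀ φ : E n → ℝ, IsTestFunction φ → ∀ e : E n,
    ∫ x, f x * fderiv ℝ φ x e = - ∫ x, inner ℝ (G x) e * φ x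

/-- Translation acts continuously on `L²`, so its pairing with a fixed `L²` function is continuous
in the shift. This is the only analytic input for the convergence of mollifications: weak
convergence is enough throughout. -/
theorem continuous_correlation {F f : E n → ℝ} (hF : MemLp F 2 volume) (hf : MemLp f 2 volume) :
    Continuous fun y : E n => ∫ x, F x * f (x - y) := by
  have : Fact ((2 : ℝ≥0∞) ≠ ⊤) := ⟨by norm_num⟩
  have h1 : Continuous fun y : E n => DomAddAct.mk (-y) +ᵥ hf.toLp f := by
    have : Continuous fun y : E n => DomAddAct.mk (-y) :=
      DomAddAct.continuous_mk.comp continuous_neg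
    exact this.vadd continuous_const
  have h2 : Continuous fun y : E n => inner ℝ (DomAddAct.mk (-y) +ᵥ hf.toLp f) (hF.toLp F) :=
    h1.inner continuous_const
  refine h2.congr fun y => ?_
  rw [L2.inner_def]
  refine integral_congr_ae ?_
  have h3 := DomAddAct.vadd_Lp_ae_eq (DomAddAct.mk (-y)) (hf.toLp f)
  have h4 : ∀ᵐ x ∂(volume : Measure (E n)), hf.toLp f (-y +ᵥ x) = f (-y +ᵥ x) :=
    (measurePreserving_vadd (-y) (volume : Measure (E n))).quasiMeasurePreserving.ae
      hf.coeFn_toLp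
  filter_upwards [h3, h4, hF.coeFn_toLp] with x h3 h4 h5
  rw [h3, h5]
  rw [Equiv.symm_apply_apply, h4]
  simp [sub_eq_neg_add]

theorem integral_mul_convolution {F f ρ : E n → ℝ} (hF : MemLp F 2 volume)
    (hf : MemLp f 2 volume) (hρ : Continuous ρ) (hρ' : HasCompactSupport ρ) :
    ∫ x, F x * convolution ρ f (ContinuousLinearMap.lsmul ℝ ℝ) volume x =
      ∫ y, ρ y * ∫ x, F x * f (x - y) := by
  have hint : Integrable (Function.uncurry fun x y : E n => F x * (ρ y * f (x - y)))
      (volume.prod volume) := by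
    have hm : AEStronglyMeasurable (Function.uncurry fun x y : E n => F x * (ρ y * f (x - y)))
        (volume.prod volume) := by
      refine hF.1.comp_fst.mul ((hρ.aestronglyMeasurable.comp_snd).mul ?_)
      exact hf.1.comp_quasiMeasurePreserving (quasiMeasurePreserving_sub volume volume)
    rw [integrable_prod_iff' hm]
    constructor
    · refine Eventually.of_forall fun y => ?_
      have h1 : MemLp (fun x => f (x - y)) 2 volume :=
        hf.comp_measurePreserving (measurePreserving_sub_right volume y)
      exact ((hF.integrable_mul h1).const_mul (ρ y)).congr
        (Eventually.of_forall fun x => by simp only [Function.uncurry, Pi.mul_apply]; ring)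
    -- Integrating the norms in `x` leaves `|ρ|` times the correlation of `|F|` and `|f|`, which is
    -- continuous with compact support; this justifies Fubini.
    · have h1 : Continuous fun y => ‖ρ y‖ * ∫ x, ‖F x‖ * ‖f (x - y)‖ :=
        hρ.norm.mul (continuous_correlation hF.norm hf.norm)
      refine (h1.integrable_of_hasCompactSupport hρ'.norm.mul_right).congr ?_
      refine Eventually.of_forall fun y => ?_
      simp only [Function.uncurry, norm_mul]
      rw [← integral_const_mul]
      congr 1
      ext x
      ring
  simp only [convolution_def, ContinuousLinearMap.lsmul_apply, smul_eq_mul, ← integral_const_mul]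
  rw [integral_integral_swap hint]
  congr 1
  ext y
  congr 1
  ext x
  ring

theorem tendsto_integral_mul_mollify {ι : Type*} {l : Filter ι} {φ : ι → ContDiffBump (0 : E n)}
    (hφ : Tendsto (fun i => (φ i).rOut) l (𝓝 0)) {F f : E n → ℝ} (hF : MemLp F 2 volume)
    (hf : MemLp f 2 volume) :
    Tendsto (fun i => ∫ x, F x *
      convolution ((φ i).normed volume) f (ContinuousLinearMap.lsmul ℝ ℝ) volume x) l
      (𝓝 (∫ x, F x * f x)) := by
  -- The integral to be studied is the mollification at `0` of this reflected correlation, so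
  -- pointwise convergence of mollified continuous functions applies.
  have hC : Continuous fun y : E n => ∫ x, F x * f (x - -y) :=
    (continuous_correlation hF hf).comp continuous_neg
  have h := ContDiffBump.convolution_tendsto_right_of_continuous (μ := (volume : Measure (E n)))
    hφ hC 0
  simp only [neg_zero, sub_zero] at h
  refine h.congr fun i => ?_
  rw [integral_mul_convolution hF hf ((φ i).contDiff_normed (n := 0)).continuous
    (φ i).hasCompactSupport_normed]
  simp [convolution_def, sub_eq_add_neg]

/-- The derivative first falls on the kernel; then `y ↦ ρ (x - y)` serves as test function in the
definition of the weak gradient. The minus sign of the reflection cancels the one from integration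
by parts. -/
theorem fderiv_convolution_of_hasWeakGradient {f : E n → ℝ} {G : E n → E n}
    (h : HasWeakGradient f G) (hf : MemLp f 2 volume) {ρ : E n → ℝ} (hρ : IsTestFunction ρ)
    (x e : E n) :
    fderiv ℝ (convolution ρ f (ContinuousLinearMap.lsmul ℝ ℝ) volume) x e =
      convolution ρ (fun y => inner ℝ (G y) e) (ContinuousLinearMap.lsmul ℝ ℝ) volume x := by
  have hd := hρ.2.hasFDerivAt_convolution_left (ContinuousLinearMap.lsmul ℝ ℝ)
    (μ := (volume : Measure (E n))) (hρ.1.of_le (by simp)) (hf.locallyIntegrable (by norm_num)) x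
  rw [hd.fderiv]
  have hl : ((convolution (fderiv ℝ ρ) f
      (ContinuousLinearMap.precompL (E n) (ContinuousLinearMap.lsmul ℝ ℝ)) volume) x) e =
      ∫ y, fderiv ℝ ρ (x - y) e * f y := by
    rw [convolution_eq_swap]
    rw [ContinuousLinearMap.integral_apply]
    · rfl
    · have hc := (hρ.2.fderiv (𝕜 := ℝ)).convolutionExists_left
        (ContinuousLinearMap.precompL (E n) (ContinuousLinearMap.lsmul ℝ ℝ))
        (hρ.1.continuous_fderiv (by simp)) (hf.locallyIntegrable (μ := volume) (by norm_num)) x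
      exact hc.integrable_swap
  rw [hl]
  have ht : IsTestFunction fun y => ρ (x - y) :=
    ⟨hρ.1.comp (contDiff_const.sub contDiff_id),
      hρ.2.comp_homeomorph (Homeomorph.subLeft x)⟩
  have hfd : ∀ y, fderiv ℝ (fun y => ρ (x - y)) y e = - fderiv ℝ ρ (x - y) e := by
    intro y
    have h1 : HasFDerivAt (fun y : E n => x - y) (-ContinuousLinearMap.id ℝ (E n)) y :=
      (hasFDerivAt_id y).const_sub x
    have h2 := (hρ.1.differentiable (by simp) (x - y)).hasFDerivAt.comp y h1
    rw [show (fun y => ρ (x - y)) = ρ ∘ fun y => x - y from rfl, h2.fderiv]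
    simp
  have := h _ ht e
  simp only [hfd, mul_neg, integral_neg, neg_inj] at this
  rw [convolution_eq_swap]
  simp only [ContinuousLinearMap.lsmul_apply, smul_eq_mul]
  rw [show (fun y => fderiv ℝ ρ (x - y) e * f y) = fun y => f y * fderiv ℝ ρ (x - y) e from
    funext fun y => mul_comm _ _, this]
  congr 1
  ext y
  ring

/-- A sequence of bump functions with supports shrinking to the origin. -/
def bumpSeq (n : ℕ) (i : ℕ) : ContDiffBump (0 : E n) where
  rIn := 1 / (2 * (i + 1))
  rOut := 1 / (i + 1)
  rIn_pos := by positivity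
  rIn_lt_rOut := by
    apply one_div_lt_one_div_of_lt <;> linarith [Nat.cast_nonneg (α := ℝ) i]

theorem tendsto_bumpSeq_rOut : Tendsto (fun i => (bumpSeq n i).rOut) atTop (𝓝 0) :=
  tendsto_one_div_add_atTop_nhds_zero_nat

/-- The mollification of `f` at scale `1 / (i + 1)`. -/
def mollify (i : ℕ) (f : E n → ℝ) : E n → ℝ :=
  convolution ((bumpSeq n i).normed volume) f (ContinuousLinearMap.lsmul ℝ ℝ) volume

theorem isTestFunction_bumpSeq (i : ℕ) :
    IsTestFunction ((bumpSeq n i).normed (volume : Measure (E n))) :=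
  ⟨(bumpSeq n i).contDiff_normed, (bumpSeq n i).hasCompactSupport_normed⟩

theorem contDiff_mollify (i : ℕ) {f : E n → ℝ} (hf : MemLp f 2 volume) :
    ContDiff ℝ ∞ (mollify i f) :=
  (isTestFunction_bumpSeq i).2.contDiff_convolution_left _ (isTestFunction_bumpSeq i).1
    (hf.locallyIntegrable (by norm_num))

theorem support_mollify_subset (i : ℕ) (f : E n → ℝ) :
    Function.support (mollify i f) ⊆ Metric.thickening (1 / ((i : ℝ) + 1)) (tsupport f) := by
  intro x hx
  obtain ⟨y, hy, z, hz, rfl⟩ := support_convolution_subset_swap _ hx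
  rw [Metric.mem_thickening_iff]
  refine ⟨y, subset_tsupport _ hy, ?_⟩
  rw [(bumpSeq n i).support_normed_eq] at hz
  simpa [dist_eq_norm, bumpSeq] using hz

theorem inner_eq_sum (v w : E n) :
    inner ℝ v w = ∑ j, inner ℝ v (EuclideanSpace.basisFun (Fin n) ℝ j) * w j := by
  rw [← (EuclideanSpace.basisFun (Fin n) ℝ).sum_inner_mul_inner v w]
  simp [EuclideanSpace.inner_single_left]

theorem clm_apply_eq_sum (T : E n →L[ℝ] ℝ) (w : E n) :
    T w = ∑ j, T (EuclideanSpace.basisFun (Fin n) ℝ j) * w j := by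
  conv_lhs => rw [← (EuclideanSpace.basisFun (Fin n) ℝ).sum_repr w]
  simp [mul_comm]

theorem MemLp.coord {B : E n → E n} (hB : MemLp B 2 volume) (j : Fin n) :
    MemLp (fun x => B x j) 2 volume :=
  hB.of_le ((EuclideanSpace.proj (𝕜 := ℝ) j).continuous.comp_aestronglyMeasurable hB.1)
    (Eventually.of_forall fun x => PiLp.norm_apply_le (B x) j)

theorem tendsto_integral_mollify {f : E n → ℝ} {G : E n → E n} (h : HasWeakGradient f G)
    (hf : MemLp f 2 volume) (hG : MemLp G 2 volume) {A : E n → ℝ} {B : E n → E n}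
    (hA : MemLp A 2 volume) (hB : MemLp B 2 volume) :
    Tendsto (fun i => (∫ x, A x * mollify i f x) +
        ∑ j, ∫ x, B x j * fderiv ℝ (mollify i f) x (EuclideanSpace.basisFun (Fin n) ℝ j)) atTop
      (𝓝 ((∫ x, A x * f x) +
        ∑ j, ∫ x, B x j * inner ℝ (G x) (EuclideanSpace.basisFun (Fin n) ℝ j))) := by
  refine (tendsto_integral_mul_mollify tendsto_bumpSeq_rOut hA hf).add ?_
  refine tendsto_finsetSum _ fun j _ => ?_
  simp only [mollify, fderiv_convolution_of_hasWeakGradient h hf (isTestFunction_bumpSeq _)]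
  exact tendsto_integral_mul_mollify tendsto_bumpSeq_rOut (MemLp.coord hB j) (hG.inner_const _)

/-! ### Weak equations tested against Sobolev functions -/

/-- Local square integrability, tested against continuous compactly supported weights. -/
def LocallyL2 {F : Type*} [NormedAddCommGroup F] [NormedSpace ℝ F] (A : E n → F) : Prop :=
  ∀ φ : E n → ℝ, Continuous φ → HasCompactSupport φ → MemLp (fun x => φ x • A x) 2 volume

theorem exists_bump_eq_one {s : Set (E n)} (hs : Bornology.IsBounded s) :
    ∃ κ : E n → ℝ, IsTestFunction κ ∧ ∀ x, ∀ y ∈ s, dist x y ≤ 1 → κ x = 1 := by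
  obtain ⟨r, hr0, hr⟩ := hs.subset_ball_lt 0 0
  let κ : ContDiffBump (0 : E n) := ⟨r + 1, r + 2, by linarith, by linarith⟩
  refine ⟨κ, ⟨κ.contDiff, κ.hasCompactSupport⟩, fun x y hy hxy => ?_⟩
  refine κ.one_of_mem_closedBall ?_
  have := hr hy
  simp only [Metric.mem_ball, Metric.mem_closedBall] at this ⊢
  calc dist x 0 ≤ dist x y + dist y 0 := dist_triangle _ _ _
    _ ≤ r + 1 := by linarith

theorem exists_bump_eq_one_of_hasCompactSupport {g : E n → ℝ} (hg : HasCompactSupport g) :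
    ∃ κ : E n → ℝ, IsTestFunction κ ∧ ∀ x ∈ tsupport g, κ x = 1 := by
  obtain ⟨κ, h1, h2⟩ := exists_bump_eq_one hg.isBounded
  exact ⟨κ, h1, fun x hx => h2 x x hx (by simp)⟩

theorem LocallyL2.integrable_mul {A : E n → ℝ} (hA : LocallyL2 A) {g : E n → ℝ}
    (hg : Continuous g) (hg' : HasCompactSupport g) : Integrable fun x => A x * g x := by
  obtain ⟨κ, h1, h2⟩ := exists_bump_eq_one_of_hasCompactSupport hg'
  refine ((hA g hg hg').integrable_mul h1.memLp).congr (Eventually.of_forall fun x => ?_)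
  by_cases hx : g x = 0
  · simp [hx]
  · simp [h2 x (subset_tsupport _ hx), mul_comm]

theorem LocallyL2.coord {B : E n → E n} (hB : LocallyL2 B) (j : Fin n) :
    LocallyL2 fun x => B x j := fun φ h1 h2 => MemLp.coord (hB φ h1 h2) j

theorem LocallyL2.add {F : Type*} [NormedAddCommGroup F] [NormedSpace ℝ F] {A A' : E n → F}
    (hA : LocallyL2 A) (hA' : LocallyL2 A') : LocallyL2 fun x => A x + A' x := by
  intro φ h1 h2
  simp only [smul_add]
  exact (hA φ h1 h2).add (hA' φ h1 h2)

theorem MemLp.bdd_smul {F : Type*} [NormedAddCommGroup F] [NormedSpace ℝ F] {A : E n → F}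
    (hA : MemLp A 2 volume) {w : E n → ℝ} (hw : Continuous w) {C : ℝ} (hC : ∀ x, |w x| ≤ C) :
    MemLp (fun x => w x • A x) 2 volume := by
  refine hA.of_le_mul (c := C) (hw.aestronglyMeasurable.smul hA.1)
    (Eventually.of_forall fun x => ?_)
  rw [norm_smul]
  exact mul_le_mul_of_nonneg_right (hC x) (norm_nonneg _)

theorem MemLp.compact_smul {F : Type*} [NormedAddCommGroup F] [NormedSpace ℝ F] {A : E n → F}
    (hA : MemLp A 2 volume) {w : E n → ℝ} (hw : Continuous w) (hw' : HasCompactSupport w) :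
    MemLp (fun x => w x • A x) 2 volume := by
  obtain ⟨C, hC⟩ := hw'.exists_bound_of_continuous hw
  exact MemLp.bdd_smul hA hw hC

theorem MemLp.locallyL2_smul {F : Type*} [NormedAddCommGroup F] [NormedSpace ℝ F] {A : E n → F}
    (hA : MemLp A 2 volume) {w : E n → ℝ} (hw : Continuous w) : LocallyL2 fun x => w x • A x := by
  intro φ h1 h2
  simp only [smul_smul]
  exact MemLp.compact_smul hA (h1.mul hw) h2.mul_right

/-- The `j`-th standard basis vector. -/
abbrev stdVec (j : Fin n) : E n := EuclideanSpace.basisFun (Fin n) ℝ j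

theorem continuous_fderiv_apply {f : E n → ℝ} (hf : ContDiff ℝ 1 f) (e : E n) :
    Continuous fun x => fderiv ℝ f x e :=
  (hf.continuous_fderiv (by simp)).clm_apply continuous_const

theorem integral_pairing_split {A : E n → ℝ} {B : E n → E n} (hA : LocallyL2 A)
    (hB : LocallyL2 B) {f : E n → ℝ} (hf : ContDiff ℝ 1 f) (hf' : HasCompactSupport f) :
    ∫ x, (A x * f x + fderiv ℝ f x (B x)) =
      (∫ x, A x * f x) + ∑ j, ∫ x, B x j * fderiv ℝ f x (stdVec j) := by
  have h1 := hA.integrable_mul hf.continuous hf'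
  have h2 : ∀ j, Integrable fun x => B x j * fderiv ℝ f x (stdVec j) := fun j =>
    (hB.coord j).integrable_mul (continuous_fderiv_apply hf _) (hf'.fderiv_apply (𝕜 := ℝ) _)
  rw [← integral_finsetSum _ fun j _ => h2 j, ← integral_add h1 (integrable_finsetSum _ fun j _ => h2 j)]
  congr 1
  ext x
  rw [clm_apply_eq_sum]
  simp only [mul_comm]

theorem hasWeakGradient_of_contDiff {φ : E n → ℝ} (hφ : ContDiff ℝ 1 φ)
    (hφ' : HasCompactSupport φ) : HasWeakGradient φ (gradient φ) := by
  intro η hη e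
  have hη1 : ContDiff ℝ 1 η := hη.1.of_le (by simp)
  have hc := hφ.continuous
  have hc' := hη1.continuous
  have hd := continuous_fderiv_apply hφ e
  have hd' := continuous_fderiv_apply hη1 e
  have := integral_mul_fderiv_eq_neg_fderiv_mul_of_integrable (μ := (volume : Measure (E n)))
    (f := φ) (g := η) (v := e)
    ((hd.mul hc').integrable_of_hasCompactSupport hη.2.mul_left)
    ((hc.mul hd').integrable_of_hasCompactSupport hφ'.mul_right)
    ((hc.mul hc').integrable_of_hasCompactSupport hφ'.mul_right)
    (fun x _ => hφ.differentiable (by simp) x) (fun x _ => hη1.differentiable (by simp) x)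
  rw [this]
  simp [gradient]

theorem memLp_gradient {φ : E n → ℝ} (hφ : ContDiff ℝ 1 φ) (hφ' : HasCompactSupport φ) :
    MemLp (gradient φ) 2 (volume : Measure (E n)) := by
  have h : Continuous (gradient φ) :=
    (InnerProductSpace.toDual ℝ (E n)).symm.continuous.comp (hφ.continuous_fderiv (by simp))
  refine h.memLp_of_hasCompactSupport ?_
  exact (hφ'.fderiv (𝕜 := ℝ)).comp_left (map_zero _)

/-- Since `q` is only `C¹`, so are the cutoffs, and a weak equation known for smooth test functions
has to be extended to `C¹` ones. Mollifying `φ` at a small scale keeps its support inside `Ω`. -/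
theorem pairing_contDiff {Ω : Set (E n)} (hΩ : IsOpen Ω) {A : E n → ℝ} {B : E n → E n}
    (hA : LocallyL2 A) (hB : LocallyL2 B)
    (h : ∀ φ : E n → ℝ, IsTestFunction φ → tsupport φ ⊆ Ω →
      ∫ x, (A x * φ x + fderiv ℝ φ x (B x)) = 0)
    {φ : E n → ℝ} (hφ : ContDiff ℝ 1 φ) (hφ' : HasCompactSupport φ) (hφΩ : tsupport φ ⊆ Ω) :
    ∫ x, (A x * φ x + fderiv ℝ φ x (B x)) = 0 := by
  -- `κ` is one on the unit neighbourhood of the support of `φ`, hence on the supports of all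
  -- mollifications used; it makes `A` and `B` globally square integrable without changing any
  -- pairing.
  obtain ⟨κ, hκ, hκ1⟩ := exists_bump_eq_one hφ'.isBounded
  obtain ⟨δ, hδ, hδΩ⟩ := hφ'.exists_cthickening_subset_open hΩ hφΩ
  have hφ2 : MemLp φ 2 (volume : Measure (E n)) :=
    hφ.continuous.memLp_of_hasCompactSupport hφ'
  have hlim := tendsto_integral_mollify (hasWeakGradient_of_contDiff hφ hφ') hφ2
    (memLp_gradient hφ hφ') (hA κ hκ.1.continuous hκ.2) (hB κ hκ.1.continuous hκ.2)
  have hrhs : (∫ x, κ x • A x * φ x) + ∑ j, ∫ x, (κ x • B x) j * inner ℝ (gradient φ x) (stdVec j)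
      = ∫ x, (A x * φ x + fderiv ℝ φ x (B x)) := by
    rw [integral_pairing_split hA hB hφ hφ']
    congr 1
    · congr 1
      ext x
      by_cases hx : φ x = 0
      · simp [hx]
      · simp [hκ1 x x (subset_tsupport _ hx) (by simp)]
    · refine Finset.sum_congr rfl fun j _ => ?_
      congr 1
      ext x
      have h0 : inner ℝ (gradient φ x) (stdVec j) = fderiv ℝ φ x (stdVec j) := by simp [gradient]
      rw [h0]
      by_cases hx : x ∈ tsupport φ
      · simp [hκ1 x x hx (by simp)]
      · have : fderiv ℝ φ x = 0 := by
          by_contra hne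
          exact hx (support_fderiv_subset ℝ hne)
        simp [this]
  rw [hrhs] at hlim
  refine tendsto_nhds_unique hlim (tendsto_const_nhds.congr' ?_)
  have hev : ∀ᶠ i : ℕ in atTop, 1 / ((i : ℝ) + 1) < δ :=
    tendsto_one_div_add_atTop_nhds_zero_nat.eventually (gt_mem_nhds hδ)
  filter_upwards [hev] with i hi
  have hts : tsupport (mollify i φ) ⊆ Metric.cthickening (1 / ((i : ℝ) + 1)) (tsupport φ) :=
    closure_minimal ((support_mollify_subset i φ).trans (Metric.thickening_subset_cthickening _ _))
      Metric.isClosed_cthickening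
  have hcs : HasCompactSupport (mollify i φ) :=
    (hφ'.cthickening).of_isClosed_subset (isClosed_tsupport _) hts
  have hsm := contDiff_mollify i hφ2
  have htest := h _ ⟨hsm, hcs⟩ (hts.trans ((Metric.cthickening_mono hi.le _).trans hδΩ))
  have hone : ∀ x ∈ tsupport (mollify i φ), κ x = 1 := by
    intro x hx
    have hx' := hts hx
    rw [IsCompact.cthickening_eq_biUnion_closedBall hφ' (by positivity)] at hx'
    simp only [mem_iUnion, Metric.mem_closedBall, exists_prop] at hx'
    obtain ⟨y, hy, hxy⟩ := hx'
    refine hκ1 x y hy (hxy.trans ?_)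
    rw [div_le_one (by positivity)]
    linarith [Nat.cast_nonneg (α := ℝ) i]
  rw [integral_pairing_split hA hB (hsm.of_le (by simp)) hcs] at htest
  rw [← htest]
  congr 1
  · congr 1
    ext x
    by_cases hx : mollify i φ x = 0
    · simp [hx]
    · simp [hone x (subset_tsupport _ hx)]
  · refine Finset.sum_congr rfl fun j _ => ?_
    congr 1
    ext x
    by_cases hx : x ∈ tsupport (mollify i φ)
    · simp [hone x hx]
    · have : fderiv ℝ (mollify i φ) x = 0 := by
        by_contra hne
        exact hx (support_fderiv_subset ℝ hne)
      simp [this]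

/-- A weak equation `A - div B = 0` in `Ω` may be tested against `ψ f` with `f ∈ H¹` and
`ψ ∈ C_c¹(Ω)`. -/
theorem pairing_sobolev {Ω : Set (E n)} (hΩ : IsOpen Ω) {A : E n → ℝ} {B : E n → E n}
    (hA : LocallyL2 A) (hB : LocallyL2 B)
    (h : ∀ φ : E n → ℝ, IsTestFunction φ → tsupport φ ⊆ Ω →
      ∫ x, (A x * φ x + fderiv ℝ φ x (B x)) = 0)
    {f : E n → ℝ} {G : E n → E n} (hfG : HasWeakGradient f G) (hf : MemLp f 2 volume)
    (hG : MemLp G 2 volume)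
    {ψ : E n → ℝ} (hψ : ContDiff ℝ 1 ψ) (hψ' : HasCompactSupport ψ) (hψΩ : tsupport ψ ⊆ Ω) :
    Integrable (fun x =>
      A x * (ψ x * f x) + (ψ x * inner ℝ (G x) (B x) + f x * fderiv ℝ ψ x (B x))) ∧
    ∫ x, (A x * (ψ x * f x) + (ψ x * inner ℝ (G x) (B x) + f x * fderiv ℝ ψ x (B x))) = 0 := by
  -- By the product rule, pairing `ψ f` with `(A, B)` is pairing `f` with `(ψ A + ∇ψ · B, ψ B)`.
  -- These fields are globally `L²`, so `f` alone is mollified.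
  have hA' : MemLp (fun x => ψ x • A x + fderiv ℝ ψ x (B x)) 2 volume := by
    refine (hA ψ hψ.continuous hψ').add ?_
    have : (fun x => fderiv ℝ ψ x (B x)) = fun x => ∑ j, fderiv ℝ ψ x (stdVec j) • B x j := by
      ext x
      rw [clm_apply_eq_sum]
      rfl
    rw [this]
    exact memLp_finsetSum _ fun j _ => (hB.coord j) _ (continuous_fderiv_apply hψ _)
      (hψ'.fderiv_apply (𝕜 := ℝ) _)
  have hB' := hB ψ hψ.continuous hψ'
  have hlim := tendsto_integral_mollify hfG hf hG hA' hB'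
  have hzero : ∀ i, (∫ x, (ψ x • A x + fderiv ℝ ψ x (B x)) * mollify i f x) +
      ∑ j, ∫ x, (ψ x • B x) j * fderiv ℝ (mollify i f) x (stdVec j) = 0 := by
    intro i
    have hsm : ContDiff ℝ 1 (mollify i f) := (contDiff_mollify i hf).of_le (by simp)
    have hprod : ContDiff ℝ 1 fun x => ψ x * mollify i f x := hψ.mul hsm
    have hprod' : HasCompactSupport fun x => ψ x * mollify i f x := hψ'.mul_right
    have htest := pairing_contDiff hΩ hA hB h hprod hprod'
      ((closure_mono (Function.support_mul_subset_left _ _)).trans hψΩ)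
    have hfd : ∀ x e, fderiv ℝ (fun x => ψ x * mollify i f x) x e =
        ψ x * fderiv ℝ (mollify i f) x e + mollify i f x * fderiv ℝ ψ x e := by
      intro x e
      rw [fderiv_fun_mul (hψ.differentiable (by simp) x) (hsm.differentiable (by simp) x)]
      simp
    have i1 : Integrable fun x => (ψ x • A x + fderiv ℝ ψ x (B x)) * mollify i f x := by
      obtain ⟨κ, hκ, hκ1⟩ := exists_bump_eq_one_of_hasCompactSupport hψ'
      have hm : MemLp (fun x => κ x * mollify i f x) 2 volume :=
        (hκ.1.continuous.mul hsm.continuous).memLp_of_hasCompactSupport hκ.2.mul_right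
      refine (hA'.integrable_mul hm).congr (Eventually.of_forall fun x => ?_)
      by_cases hx : x ∈ tsupport ψ
      · simp [hκ1 x hx]
      · have h2 : fderiv ℝ ψ x = 0 := by
          by_contra hne
          exact hx (support_fderiv_subset ℝ hne)
        simp [h2, image_eq_zero_of_notMem_tsupport hx]
    have i2 : ∀ j, Integrable fun x => (ψ x • B x) j * fderiv ℝ (mollify i f) x (stdVec j) := by
      intro j
      refine ((hB.coord j).integrable_mul (hψ.continuous.mul (continuous_fderiv_apply hsm
        (stdVec j))) hψ'.mul_right).congr (Eventually.of_forall fun x => ?_)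
      simp only [PiLp.smul_apply, smul_eq_mul, Pi.mul_apply]
      ring
    rw [← htest, ← integral_finsetSum _ fun j _ => i2 j,
      ← integral_add i1 (integrable_finsetSum _ fun j _ => i2 j)]
    congr 1
    ext x
    rw [hfd, clm_apply_eq_sum (fderiv ℝ (mollify i f) x) (B x), Finset.mul_sum, smul_eq_mul]
    simp only [PiLp.smul_apply, smul_eq_mul]
    have : ∀ j, ψ x * B x j * fderiv ℝ (mollify i f) x (stdVec j) =
        ψ x * (fderiv ℝ (mollify i f) x (stdVec j) * B x j) := fun j => by ring
    simp only [this]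
    ring
  have h0 := tendsto_nhds_unique hlim (tendsto_const_nhds.congr fun i => (hzero i).symm)
  have i1 : Integrable fun x => (ψ x • A x + fderiv ℝ ψ x (B x)) * f x := hA'.integrable_mul hf
  have i2 : ∀ j, Integrable fun x => (ψ x • B x) j * inner ℝ (G x) (stdVec j) := fun j =>
    (MemLp.coord hB' j).integrable_mul (hG.inner_const (stdVec j))
  have hsum : (fun x => A x * (ψ x * f x) +
      (ψ x * inner ℝ (G x) (B x) + f x * fderiv ℝ ψ x (B x))) =
      fun x => (ψ x • A x + fderiv ℝ ψ x (B x)) * f x +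
        ∑ j, (ψ x • B x) j * inner ℝ (G x) (stdVec j) := by
    ext x
    rw [inner_eq_sum (G x), Finset.mul_sum, smul_eq_mul]
    simp only [PiLp.smul_apply, smul_eq_mul]
    have : ∀ j, ψ x * B x j * inner ℝ (G x) (stdVec j) =
        ψ x * (inner ℝ (G x) (stdVec j) * B x j) := fun j => by ring
    simp only [this]
    ring
  rw [hsum]
  refine ⟨i1.add (integrable_finsetSum _ fun j _ => i2 j), ?_⟩
  rw [integral_add i1 (integrable_finsetSum _ fun j _ => i2 j),
    integral_finsetSum _ fun j _ => i2 j, h0]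

/-! ### Multiplication operators on `L²` -/

section Mul

variable {F : Type*} [NormedAddCommGroup F] [NormedSpace ℝ F]

theorem memLp_bcf_smul (k : E n →ᵇ ℝ) (f : Lp F 2 (volume : Measure (E n))) :
    MemLp (fun x => k x • f x) 2 (volume : Measure (E n)) :=
  MemLp.bdd_smul (Lp.memLp f) k.continuous (C := ‖k‖) fun x => k.norm_coe_le_norm x

/-- Multiplication of `L²` functions by bounded continuous functions. -/
def mulL2 : (E n →ᵇ ℝ) →L[ℝ] Lp F 2 (volume : Measure (E n)) →L[ℝ]
    Lp F 2 (volume : Measure (E n)) :=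
  LinearMap.mkContinuous₂
    (LinearMap.mk₂ ℝ (fun k f => (memLp_bcf_smul k f).toLp _)
      (by
        intro k k' f
        rw [← MemLp.toLp_add]
        refine MemLp.toLp_congr _ _ (Eventually.of_forall fun x => ?_)
        simp [add_smul])
      (by
        intro c k f
        rw [← MemLp.toLp_const_smul]
        refine MemLp.toLp_congr _ _ (Eventually.of_forall fun x => ?_)
        simp [smul_smul])
      (by
        intro k f g
        rw [← MemLp.toLp_add]
        refine MemLp.toLp_congr _ _ ?_
        filter_upwards [Lp.coeFn_add f g] with x hx
        rw [hx, Pi.add_apply, smul_add, Pi.add_apply])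
      (by
        intro c k f
        rw [← MemLp.toLp_const_smul]
        refine MemLp.toLp_congr _ _ ?_
        filter_upwards [Lp.coeFn_smul c f] with x hx
        rw [hx, Pi.smul_apply, Pi.smul_apply, smul_comm])) 1
    (by
      intro k f
      rw [one_mul]
      refine Lp.norm_le_mul_norm_of_ae_le_mul ?_
      filter_upwards [(memLp_bcf_smul k f).coeFn_toLp] with x hx
      rw [LinearMap.mk₂_apply, hx, norm_smul]
      exact mul_le_mul_of_nonneg_right (k.norm_coe_le_norm x) (norm_nonneg _))

theorem coeFn_mulL2 (k : E n →ᵇ ℝ) (f : Lp F 2 (volume : Measure (E n))) :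
    mulL2 k f =ᵐ[volume] fun x => k x • f x :=
  (memLp_bcf_smul k f).coeFn_toLp

attribute [irreducible] mulL2

end Mul

section Form

variable {F : Type*} [NormedAddCommGroup F] [InnerProductSpace ℝ F]

theorem inner_mulL2 (k : E n →ᵇ ℝ) (f g : Lp F 2 (volume : Measure (E n))) :
    inner ℝ (mulL2 k f) g = ∫ x, k x * inner ℝ (f x) (g x) := by
  rw [L2.inner_def]
  refine integral_congr_ae ?_
  filter_upwards [coeFn_mulL2 k f] with x hx
  rw [hx, real_inner_smul_left]

theorem integrable_bcf_mul_inner (k : E n →ᵇ ℝ) (f g : Lp F 2 (volume : Measure (E n))) :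
    Integrable fun x => k x * inner ℝ (f x) (g x) := by
  refine (L2.integrable_inner (𝕜 := ℝ) (mulL2 k f) g).congr ?_
  filter_upwards [coeFn_mulL2 k f] with x hx
  rw [hx, real_inner_smul_left]

theorem integrable_bcf_mul_norm_sq (k : E n →ᵇ ℝ) (f : Lp F 2 (volume : Measure (E n))) :
    Integrable fun x => k x * ‖f x‖ ^ 2 := by
  simpa only [real_inner_self_eq_norm_sq] using integrable_bcf_mul_inner k f f

theorem inner_mulL2_self (k : E n →ᵇ ℝ) (f : Lp F 2 (volume : Measure (E n))) :
    inner ℝ (mulL2 k f) f = ∫ x, k x * ‖f x‖ ^ 2 := by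
  rw [inner_mulL2]
  simp only [real_inner_self_eq_norm_sq]

theorem continuousWithinAt_weightedForm {k : ℝ → E n →ᵇ ℝ}
    {f : ℝ → Lp F 2 (volume : Measure (E n))} {s : Set ℝ} {t : ℝ}
    (hk : ContinuousWithinAt k s t) (hf : ContinuousWithinAt f s t) :
    ContinuousWithinAt (fun s => ∫ x, k s x * ‖f s x‖ ^ 2) s t := by
  simp only [← inner_mulL2_self]
  exact (((mulL2 (F := F)).continuous.continuousAt.comp_continuousWithinAt hk).clm_apply hf).inner
    hf

/-- The expression is a continuous trilinear form in the weight, in sup norm, and two copies of `f`,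
in `L²`. The product rule replaces differentiation under the integral sign, at the price of weights
differentiable in sup norm. -/
theorem hasDerivAt_weightedForm {k : ℝ → E n →ᵇ ℝ} {k' : E n →ᵇ ℝ}
    {f : ℝ → Lp F 2 (volume : Measure (E n))} {f' : Lp F 2 (volume : Measure (E n))} {t : ℝ}
    (hk : HasDerivAt k k' t) (hf : HasDerivAt f f' t) :
    HasDerivAt (fun s => ∫ x, k s x * ‖f s x‖ ^ 2)
      ((∫ x, k' x * ‖f t x‖ ^ 2) + 2 * ∫ x, k t x * inner ℝ (f t x) (f' x)) t := by
  simp only [← inner_mulL2_self, ← inner_mulL2]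
  have h1 := (mulL2 (n := n) (F := F)).hasDerivAt_of_bilinear (fun _ => hk) (fun _ => hf)
  have h2 := h1.inner ℝ hf
  have : inner ℝ (mulL2 (k t) f') (f t) = inner ℝ (mulL2 (k t) (f t)) f' := by
    rw [inner_mulL2, inner_mulL2]
    congr 1
    ext x
    rw [real_inner_comm]
  rw [inner_add_left, this] at h2
  refine h2.congr_deriv ?_
  ring

theorem norm_mulL2_sq (k : E n →ᵇ ℝ) (f : Lp F 2 (volume : Measure (E n))) :
    ‖mulL2 k f‖ ^ 2 = ∫ x, k x ^ 2 * ‖f x‖ ^ 2 := by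
  rw [← real_inner_self_eq_norm_sq, L2.inner_def]
  refine integral_congr_ae ?_
  filter_upwards [coeFn_mulL2 k f] with x hx
  rw [hx, real_inner_self_eq_norm_sq, norm_smul, mul_pow, Real.norm_eq_abs, sq_abs]

end Form

/-! ### A smooth step and its translates -/

/-- The derivative of the smooth step. -/
def stepDeriv (s : ℝ) : ℝ := deriv Real.smoothTransition s

theorem hasDerivAt_step (s : ℝ) : HasDerivAt Real.smoothTransition (stepDeriv s) s :=
  ((Real.smoothTransition.contDiff (n := 1)).differentiable (by simp) s).hasDerivAt

theorem contDiff_stepDeriv : ContDiff ℝ 1 stepDeriv := by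
  have h : ContDiff ℝ (1 + 1) Real.smoothTransition :=
    Real.smoothTransition.contDiff (n := (1 + 1 : ℕ))
  exact (contDiff_succ_iff_deriv.1 h).2.2

theorem stepDeriv_nonneg (s : ℝ) : 0 ≤ stepDeriv s := Real.smoothTransition.monotone.deriv_nonneg

theorem stepDeriv_eq_zero_of_neg {s : ℝ} (hs : s < 0) : stepDeriv s = 0 := by
  have : Real.smoothTransition =ᶠ[𝓝 s] fun _ => 0 := by
    filter_upwards [gt_mem_nhds hs] with r hr using Real.smoothTransition.zero_of_nonpos hr.le
  rw [stepDeriv, this.deriv_eq, deriv_const]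

theorem stepDeriv_eq_zero_of_one_lt {s : ℝ} (hs : 1 < s) : stepDeriv s = 0 := by
  have : Real.smoothTransition =ᶠ[𝓝 s] fun _ => 1 := by
    filter_upwards [lt_mem_nhds hs] with r hr using Real.smoothTransition.one_of_one_le hr.le
  rw [stepDeriv, this.deriv_eq, deriv_const]

theorem stepDeriv_eq_zero_of_nonpos {s : ℝ} (hs : s ≤ 0) : stepDeriv s = 0 := by
  have h : Tendsto stepDeriv (𝓝[<] 0) (𝓝 (stepDeriv 0)) :=
    contDiff_stepDeriv.continuous.continuousWithinAt
  rcases hs.lt_or_eq with h1 | rfl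
  · exact stepDeriv_eq_zero_of_neg h1
  · refine tendsto_nhds_unique h (tendsto_const_nhds.congr' ?_)
    filter_upwards [self_mem_nhdsWithin] with r hr using (stepDeriv_eq_zero_of_neg hr).symm

theorem hasCompactSupport_stepDeriv : HasCompactSupport stepDeriv :=
  HasCompactSupport.intro (isCompact_Icc (a := 0) (b := 1)) fun s hs => by
    rcases not_and_or.1 hs with h | h
    · exact stepDeriv_eq_zero_of_neg (not_le.1 h)
    · exact stepDeriv_eq_zero_of_one_lt (not_le.1 h)

theorem exists_stepDeriv_le : ∃ C, ∀ s, ‖stepDeriv s‖ ≤ C :=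
  hasCompactSupport_stepDeriv.exists_bound_of_continuous contDiff_stepDeriv.continuous

/-- The smooth step as a bounded continuous function. -/
def stepBCF : ℝ →ᵇ ℝ :=
  .ofNormedAddCommGroup Real.smoothTransition Real.smoothTransition.continuous 1 fun s => by
    rw [Real.norm_of_nonneg (Real.smoothTransition.nonneg s)]
    exact Real.smoothTransition.le_one s

/-- The derivative of the smooth step as a bounded continuous function. -/
def stepDerivBCF : ℝ →ᵇ ℝ :=
  .ofNormedAddCommGroup stepDeriv contDiff_stepDeriv.continuous exists_stepDeriv_le.choose
    exists_stepDeriv_le.choose_spec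

/-- `stepDeriv` is `C¹` with compact support, hence Lipschitz, and the mean value inequality gives a
quadratic remainder. Its uniformity in `u` yields the sup-norm differentiability in
`hasDerivAt_translate`. -/
theorem exists_step_taylor :
    ∃ C : ℝ, 0 ≤ C ∧ ∀ u h : ℝ,
      |Real.smoothTransition (u + h) - Real.smoothTransition u - h * stepDeriv u| ≤ C * h ^ 2 := by
  obtain ⟨C, hC⟩ := contDiff_stepDeriv.lipschitzWith_of_hasCompactSupport
    hasCompactSupport_stepDeriv (by simp)
  refine ⟨C, C.2, fun u h => ?_⟩
  have hd : ∀ r, HasDerivAt (fun r => Real.smoothTransition (u + r) - r * stepDeriv u)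
      (stepDeriv (u + r) - stepDeriv u) r := by
    intro r
    have h1 : HasDerivAt (fun r => u + r) 1 r := (hasDerivAt_id r).const_add u
    have h2 := (hasDerivAt_step (u + r)).comp r h1
    rw [mul_one] at h2
    have h3 := (hasDerivAt_id r).mul_const (stepDeriv u)
    rw [one_mul] at h3
    exact h2.sub h3
  have hb : ∀ r ∈ Metric.closedBall (0 : ℝ) |h|, ‖stepDeriv (u + r) - stepDeriv u‖ ≤ C * |h| := by
    intro r hr
    have := hC.dist_le_mul (u + r) u
    rw [dist_eq_norm, dist_eq_norm, add_sub_cancel_left] at this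
    refine this.trans (mul_le_mul_of_nonneg_left ?_ C.2)
    simpa using hr
  have := (convex_closedBall (0 : ℝ) |h|).norm_image_sub_le_of_norm_hasDerivWithin_le
    (fun r _ => (hd r).hasDerivWithinAt) hb (Metric.mem_closedBall_self (abs_nonneg h))
    (y := h) (by simp)
  simp only [add_zero, zero_mul, sub_zero, Real.norm_eq_abs] at this
  calc _ = |Real.smoothTransition (u + h) - h * stepDeriv u - Real.smoothTransition u| := by
        congr 1; ring
    _ ≤ C * |h| * |h| := this
    _ = C * h ^ 2 := by rw [mul_assoc, ← sq, sq_abs]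

/-- The function `x ↦ χ (p x + κ t)`, for a bounded continuous function `χ`. -/
def translate (χ : ℝ →ᵇ ℝ) (p : C(E n, ℝ)) (κ t : ℝ) : E n →ᵇ ℝ :=
  χ.compContinuous (p + ContinuousMap.const _ (κ * t))

theorem hasDerivAt_translate (p : C(E n, ℝ)) (κ t : ℝ) :
    HasDerivAt (translate stepBCF p κ) (κ • translate stepDerivBCF p κ t) t := by
  obtain ⟨C, hC0, hC⟩ := exists_step_taylor
  rw [hasDerivAt_iff_isLittleO]
  have hO : (fun s => translate stepBCF p κ s - translate stepBCF p κ t -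
      (s - t) • κ • translate stepDerivBCF p κ t) =O[𝓝 t] fun s => (s - t) ^ 2 := by
    refine Asymptotics.IsBigO.of_bound (C * κ ^ 2) (Eventually.of_forall fun s => ?_)
    refine (BoundedContinuousFunction.norm_le (by positivity)).2 fun x => ?_
    have := hC (p x + κ * t) (κ * (s - t))
    rw [show p x + κ * t + κ * (s - t) = p x + κ * s by ring] at this
    rw [Real.norm_eq_abs (((s - t) : ℝ) ^ 2), abs_of_nonneg (sq_nonneg (s - t))]
    calc _ = |Real.smoothTransition (p x + κ * s) - Real.smoothTransition (p x + κ * t)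
          - κ * (s - t) * stepDeriv (p x + κ * t)| := by
          simp only [translate, stepBCF, stepDerivBCF, BoundedContinuousFunction.coe_sub,
            BoundedContinuousFunction.coe_smul, Pi.sub_apply, Real.norm_eq_abs, smul_eq_mul,
            BoundedContinuousFunction.compContinuous_apply, ContinuousMap.add_apply,
            ContinuousMap.const_apply, BoundedContinuousFunction.coe_ofNormedAddCommGroup]
          congr 1
          ring
      _ ≤ C * (κ * (s - t)) ^ 2 := this
      _ = C * κ ^ 2 * (s - t) ^ 2 := by ring
  refine hO.trans_isLittleO ?_
  simpa only [Real.norm_eq_abs, sq_abs] using Asymptotics.isLittleO_pow_sub_sub t one_lt_two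

@[simp]
theorem translate_step_apply (p : C(E n, ℝ)) (κ t : ℝ) (x : E n) :
    translate stepBCF p κ t x = Real.smoothTransition (p x + κ * t) := rfl

@[simp]
theorem translate_stepDeriv_apply (p : C(E n, ℝ)) (κ t : ℝ) (x : E n) :
    translate stepDerivBCF p κ t x = stepDeriv (p x + κ * t) := rfl

/-! ### Radial cutoffs -/

/-- The inner cutoff `x ↦ χ (q |x| - A)`. -/
def radialStep (q : ℝ → ℝ) (A : ℝ) (x : E n) : ℝ := Real.smoothTransition (q ‖x‖ - A)

/-- The outer cutoff `x ↦ χ (a - ε log (1 + |x|²))`. -/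
def logCutoff (ε a : ℝ) (x : E n) : ℝ :=
  Real.smoothTransition (a - ε * Real.log (1 + ‖x‖ ^ 2))

theorem continuous_comp_norm {q : ℝ → ℝ} (hq : ContinuousOn q (Ici 0)) :
    Continuous fun x : E n => q ‖x‖ :=
  hq.comp_continuous continuous_norm fun x => norm_nonneg x

theorem strictMonoOn_of_derivWithin_pos {q : ℝ → ℝ} (hq : ContinuousOn q (Ici 0))
    (hq' : ∀ r, 0 ≤ r → 0 < derivWithin q (Ici 0) r) : StrictMonoOn q (Ici 0) := by
  refine strictMonoOn_of_deriv_pos (convex_Ici 0) hq fun r hr => ?_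
  rw [interior_Ici] at hr
  rw [← derivWithin_of_mem_nhds (Ici_mem_nhds hr)]
  exact hq' r (le_of_lt hr)

/-- The norm is not differentiable at the origin; the condition `q 0 < A` switches the step off
there, which is what makes the radial cutoff `C¹`. -/
theorem radialStep_eventuallyEq_zero {q : ℝ → ℝ} (hq : ContinuousOn q (Ici 0)) {A : ℝ}
    (hA : q 0 < A) : (radialStep q A : E n → ℝ) =ᶠ[𝓝 0] fun _ => 0 := by
  have h : ∀ᶠ x : E n in 𝓝 0, q ‖x‖ < A := by
    refine (continuous_comp_norm hq).continuousAt.eventually (gt_mem_nhds ?_)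
    simpa using hA
  filter_upwards [h] with x hx
  exact Real.smoothTransition.zero_of_nonpos (by linarith)

theorem hasFDerivAt_norm_of_ne_zero {x : E n} (hx : x ≠ 0) :
    HasFDerivAt (fun y : E n => ‖y‖) (‖x‖⁻¹ • innerSL ℝ x) x := by
  have h1 := (hasStrictFDerivAt_norm_sq x).hasFDerivAt.sqrt (pow_ne_zero 2 (norm_ne_zero_iff.2 hx))
  simp only [Real.sqrt_sq (norm_nonneg _)] at h1
  refine h1.congr_fderiv ?_
  ext v
  simp
  field_simp

theorem hasFDerivAt_radialStep {q : ℝ → ℝ} (hq : ContDiffOn ℝ 1 q (Ici 0)) {A : ℝ}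
    (hA : q 0 < A) (x : E n) :
    HasFDerivAt (radialStep q A)
      ((stepDeriv (q ‖x‖ - A) * derivWithin q (Ici 0) ‖x‖ * ‖x‖⁻¹) • innerSL ℝ x) x := by
  rcases eq_or_ne x 0 with rfl | hx
  · refine ((hasFDerivAt_const (0 : ℝ) (0 : E n)).congr_of_eventuallyEq
      (radialStep_eventuallyEq_zero hq.continuousOn hA)).congr_fderiv ?_
    simp
  · have hx0 : 0 < ‖x‖ := norm_pos_iff.2 hx
    have h1 : HasDerivAt q (derivWithin q (Ici 0) ‖x‖) ‖x‖ :=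
      ((hq.differentiableOn (by simp)) ‖x‖ hx0.le).hasDerivWithinAt.hasDerivAt (Ici_mem_nhds hx0)
    have h2 : HasDerivAt (fun r => Real.smoothTransition (q r - A))
        (stepDeriv (q ‖x‖ - A) * derivWithin q (Ici 0) ‖x‖) ‖x‖ :=
      (hasDerivAt_step _).comp ‖x‖ (h1.sub_const A)
    refine (h2.comp_hasFDerivAt x (hasFDerivAt_norm_of_ne_zero hx)).congr_fderiv ?_
    rw [smul_smul]

theorem contDiff_radialStep {q : ℝ → ℝ} (hq : ContDiffOn ℝ 1 q (Ici 0)) {A : ℝ}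
    (hA : q 0 < A) : ContDiff ℝ 1 (radialStep q A : E n → ℝ) := by
  rw [contDiff_iff_contDiffAt]
  intro x
  rcases eq_or_ne x 0 with rfl | hx
  · exact contDiffAt_const.congr_of_eventuallyEq (radialStep_eventuallyEq_zero hq.continuousOn hA)
  · have h1 : ContDiffAt ℝ 1 q ‖x‖ := hq.contDiffAt (Ici_mem_nhds (norm_pos_iff.2 hx))
    exact (Real.smoothTransition.contDiffAt (n := 1)).comp x
      ((h1.comp x (contDiffAt_norm ℝ hx)).sub contDiffAt_const)

theorem radialStep_nonneg (q : ℝ → ℝ) (A : ℝ) (x : E n) : 0 ≤ radialStep q A x :=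
  Real.smoothTransition.nonneg _

theorem radialStep_le_one (q : ℝ → ℝ) (A : ℝ) (x : E n) : radialStep q A x ≤ 1 :=
  Real.smoothTransition.le_one _

theorem logCutoff_nonneg (ε a : ℝ) (x : E n) : 0 ≤ logCutoff ε a x :=
  Real.smoothTransition.nonneg _

theorem logCutoff_le_one (ε a : ℝ) (x : E n) : logCutoff ε a x ≤ 1 :=
  Real.smoothTransition.le_one _

theorem one_add_norm_sq_pos (x : E n) : 0 < 1 + ‖x‖ ^ 2 := by positivity

theorem contDiff_log_one_add_norm_sq {m : ℕ∞} :
    ContDiff ℝ m fun x : E n => Real.log (1 + ‖x‖ ^ 2) :=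
  (contDiff_const.add (contDiff_norm_sq ℝ)).log fun x => (one_add_norm_sq_pos x).ne'

theorem contDiff_logCutoff (ε a : ℝ) {m : ℕ∞} : ContDiff ℝ m (logCutoff ε a : E n → ℝ) :=
  Real.smoothTransition.contDiff.comp
    (contDiff_const.sub (contDiff_const.mul contDiff_log_one_add_norm_sq))

theorem hasFDerivAt_log_one_add_norm_sq (x : E n) :
    HasFDerivAt (fun x : E n => Real.log (1 + ‖x‖ ^ 2)) ((2 / (1 + ‖x‖ ^ 2)) • innerSL ℝ x) x := by
  refine (((hasStrictFDerivAt_norm_sq x).hasFDerivAt.const_add 1).log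
    (one_add_norm_sq_pos x).ne').congr_fderiv ?_
  ext v
  simp
  ring

theorem hasFDerivAt_logCutoff (ε a : ℝ) (x : E n) :
    HasFDerivAt (logCutoff ε a)
      (-(stepDeriv (a - ε * Real.log (1 + ‖x‖ ^ 2)) * ε * (2 / (1 + ‖x‖ ^ 2))) • innerSL ℝ x)
      x := by
  have h1 := ((hasFDerivAt_log_one_add_norm_sq x).const_mul ε).const_sub a
  refine ((hasDerivAt_step _).comp_hasFDerivAt x h1).congr_fderiv ?_
  ext v
  simp
  ring

theorem hasCompactSupport_logCutoff {ε : ℝ} (hε : 0 < ε) (a : ℝ) :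
    HasCompactSupport (logCutoff ε a : E n → ℝ) := by
  -- Outside this ball `1 + ‖x‖² ≥ 2 ‖x‖ > exp (a / ε)`, so the argument of the step is negative.
  refine HasCompactSupport.intro (isCompact_closedBall (0 : E n) (Real.exp (a / ε)))
    fun x hx => Real.smoothTransition.zero_of_nonpos ?_
  rw [mem_closedBall_zero_iff, not_le] at hx
  have h0 : 0 < Real.exp (a / ε) := Real.exp_pos _
  have h1 : a / ε ≤ Real.log (1 + ‖x‖ ^ 2) := by
    rw [Real.le_log_iff_exp_le (one_add_norm_sq_pos x)]
    nlinarith [sq_nonneg (‖x‖ - 1)]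
  rw [div_le_iff₀ hε] at h1
  linarith

theorem logCutoff_eq_one {ε a : ℝ} {x : E n} (h : ε * Real.log (1 + ‖x‖ ^ 2) ≤ a - 1) :
    logCutoff ε a x = 1 := Real.smoothTransition.one_of_one_le (by linarith)

theorem log_lt_of_logCutoff_ne_zero {ε a : ℝ} {x : E n} (h : logCutoff ε a x ≠ 0) :
    ε * Real.log (1 + ‖x‖ ^ 2) < a := by
  by_contra hc
  exact h (Real.smoothTransition.zero_of_nonpos (by linarith))

/-- The margin `δ` puts the closed support inside the open exterior region, as testing the weak
equation requires. -/
theorem radialStep_mem_exterior {q : ℝ → ℝ} {R t δ : ℝ} {x : E n} (hδ : 0 < δ)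
    (hq : ContinuousOn q (Ici 0)) (hx : x ∈ tsupport (radialStep q (t + q R + δ) : E n → ℝ)) :
    x ∈ exterior n q R t := by
  have h : IsClosed {x : E n | t + q R + δ ≤ q ‖x‖} :=
    isClosed_le continuous_const (continuous_comp_norm hq)
  have h1 : tsupport (radialStep q (t + q R + δ) : E n → ℝ) ⊆ {x : E n | t + q R + δ ≤ q ‖x‖} := by
    refine closure_minimal (fun y hy => ?_) h
    by_contra hc
    exact hy (Real.smoothTransition.zero_of_nonpos (by
      simp only [mem_ofPred_eq, not_le] at hc
      linarith))
  have := h1 hx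
  simp only [mem_ofPred_eq] at this
  simp only [exterior, mem_ofPred_eq]
  linarith

theorem isOpen_exterior {q : ℝ → ℝ} (hq : ContinuousOn q (Ici 0)) (R t : ℝ) :
    IsOpen (exterior n q R t) := isOpen_lt continuous_const (continuous_comp_norm hq)

theorem exterior_anti (q : ℝ → ℝ) (R : ℝ) {s t : ℝ} (h : s ≤ t) :
    exterior n q R t ⊆ exterior n q R s := fun x hx => by
  simp only [exterior, mem_ofPred_eq] at *
  linarith

theorem lt_norm_of_mem_exterior {q : ℝ → ℝ} (hq : StrictMonoOn q (Ici 0)) {R t : ℝ} (hR : 0 ≤ R)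
    (ht : 0 ≤ t) {x : E n} (hx : x ∈ exterior n q R t) : R < ‖x‖ := by
  refine (hq.lt_iff_lt hR (norm_nonneg x)).1 ?_
  simp only [exterior, mem_ofPred_eq] at hx
  linarith

/-! ### A weighted Hardy inequality -/

theorem integrable_compact_mul_mul {k f g : E n → ℝ} (hk : Continuous k)
    (hk' : HasCompactSupport k) (hf : MemLp f 2 volume) (hg : MemLp g 2 volume) :
    Integrable fun x => k x * (f x * g x) := by
  refine ((MemLp.compact_smul hf hk hk').integrable_mul hg).congr
    (Eventually.of_forall fun x => ?_)
  simp [mul_assoc]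

theorem integrable_compact_mul_sq_norm {F : Type*} [NormedAddCommGroup F] {k : E n → ℝ}
    (hk : Continuous k) (hk' : HasCompactSupport k) {G : E n → F} (hG : MemLp G 2 volume) :
    Integrable fun x => k x * ‖G x‖ ^ 2 := by
  simpa only [sq] using integrable_compact_mul_mul hk hk' hG.norm hG.norm

/-- This is `∫ div (f² Y x) = 0`. In each coordinate the relation defining the weak derivative is
itself read as a weak equation, with `A = ∂ⱼf` and `B = f eⱼ`, and is tested against `(Y xⱼ) f`. -/
theorem integral_radial_field {f : E n → ℝ} {G : E n → E n} (hfG : HasWeakGradient f G)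
    (hf : MemLp f 2 volume) (hG : MemLp G 2 volume) {Y : E n → ℝ} (hY : ContDiff ℝ 1 Y)
    (hY' : HasCompactSupport Y) :
    Integrable (fun x => 2 * (Y x * (f x * inner ℝ (G x) x)) +
      f x ^ 2 * (n * Y x + fderiv ℝ Y x x)) ∧
    ∫ x, (2 * (Y x * (f x * inner ℝ (G x) x)) + f x ^ 2 * (n * Y x + fderiv ℝ Y x x)) = 0 := by
  have hcoord : ∀ j : Fin n, ContDiff ℝ 1 fun x : E n => x j := fun j =>
    (EuclideanSpace.proj (𝕜 := ℝ) j).contDiff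
  have hψ : ∀ j, ContDiff ℝ 1 fun x : E n => Y x * x j := fun j => hY.mul (hcoord j)
  have hψ' : ∀ j, HasCompactSupport fun x : E n => Y x * x j := fun j => hY'.mul_right
  have hGj : ∀ j, MemLp (fun x => inner ℝ (G x) (stdVec j)) 2 volume := fun j => hG.inner_const _
  have hfd : ∀ (j : Fin n) (x v : E n), fderiv ℝ (fun x : E n => Y x * x j) x v =
      Y x * v j + x j * fderiv ℝ Y x v := by
    intro j x v
    have h1 : HasFDerivAt (fun x : E n => x j) (EuclideanSpace.proj (𝕜 := ℝ) j) x :=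
      (EuclideanSpace.proj (𝕜 := ℝ) j).hasFDerivAt
    rw [fderiv_fun_mul (hY.differentiable (by simp) x) h1.differentiableAt, h1.fderiv]
    simp
  have hvec : ∀ j, MemLp (fun x => f x • (stdVec j : E n)) 2 volume := fun j =>
    hf.of_le_mul (c := 1) (hf.1.smul aestronglyMeasurable_const) (Eventually.of_forall fun x => by
      simp [norm_smul])
  have hloc : ∀ {F : Type} [NormedAddCommGroup F] [NormedSpace ℝ F] {A : E n → F},
      MemLp A 2 volume → LocallyL2 A := fun hA φ h1 h2 => MemLp.compact_smul hA h1 h2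
  have key : ∀ j, ∫ x, (2 * ((Y x * x j) * (f x * inner ℝ (G x) (stdVec j))) +
      (Y x + x j * fderiv ℝ Y x (stdVec j)) * (f x * f x)) = 0 := by
    intro j
    have h := pairing_sobolev isOpen_univ (hloc (hGj j)) (hloc (hvec j)) ?_ hfG hf hG
      (hψ j) (hψ' j) (subset_univ _)
    · rw [← h.2]
      congr 1
      ext x
      rw [hfd, map_smul, real_inner_smul_right]
      simp
      ring
    · intro φ hφ _
      have h1 := hfG φ hφ (stdVec j)
      rw [integral_add]
      · simp only [map_smul, smul_eq_mul]
        rw [h1]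
        ring
      · exact (hGj j).integrable_mul hφ.memLp
      · simp only [map_smul, smul_eq_mul]
        exact hf.integrable_mul (hφ.memLp_fderiv _)
  have hint : ∀ j, Integrable fun x => 2 * ((Y x * x j) * (f x * inner ℝ (G x) (stdVec j))) +
      (Y x + x j * fderiv ℝ Y x (stdVec j)) * (f x * f x) := by
    intro j
    refine ((integrable_compact_mul_mul (hψ j).continuous (hψ' j) hf (hGj j)).const_mul 2).add
      (integrable_compact_mul_mul ?_ ?_ hf hf)
    · exact hY.continuous.add ((hcoord j).continuous.mul (continuous_fderiv_apply hY _))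
    · exact hY'.add (hY'.fderiv_apply (𝕜 := ℝ) _).mul_left
  have hsum : (fun x => 2 * (Y x * (f x * inner ℝ (G x) x)) +
      f x ^ 2 * (n * Y x + fderiv ℝ Y x x)) = fun x =>
      ∑ j, (2 * ((Y x * x j) * (f x * inner ℝ (G x) (stdVec j))) +
      (Y x + x j * fderiv ℝ Y x (stdVec j)) * (f x * f x)) := by
    ext x
    rw [Finset.sum_add_distrib, ← Finset.mul_sum, ← Finset.sum_mul, Finset.sum_add_distrib,
      inner_eq_sum, clm_apply_eq_sum (fderiv ℝ Y x) x, Finset.mul_sum, Finset.mul_sum]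
    simp only [Finset.sum_const, Finset.card_univ, Fintype.card_fin, nsmul_eq_mul]
    have h1 : ∀ j, Y x * (f x * (inner ℝ (G x) (EuclideanSpace.basisFun (Fin n) ℝ j) * x j)) =
        Y x * x j * (f x * inner ℝ (G x) (stdVec j)) := fun j => by ring
    have h2 : ∀ j, fderiv ℝ Y x (EuclideanSpace.basisFun (Fin n) ℝ j) * x j =
        x j * fderiv ℝ Y x (stdVec j) := fun j => by ring
    simp only [h1, h2]
    ring
  rw [hsum]
  refine ⟨integrable_finsetSum _ fun j _ => hint j, ?_⟩
  rw [integral_finsetSum _ fun j _ => hint j]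
  exact Finset.sum_eq_zero fun j _ => key j

/-- A bounded truncation of the weight `(1 + |x|²)^s`. -/
def truncWeight (ε s : ℝ) (x : E n) : ℝ := (Real.exp (-(s * Real.log (1 + ‖x‖ ^ 2))) + ε)⁻¹

theorem log_one_add_norm_sq_nonneg (x : E n) : 0 ≤ Real.log (1 + ‖x‖ ^ 2) :=
  Real.log_nonneg (by nlinarith [sq_nonneg ‖x‖])

theorem truncWeight_denom_pos {ε : ℝ} (hε : 0 < ε) (s : ℝ) (x : E n) :
    0 < Real.exp (-(s * Real.log (1 + ‖x‖ ^ 2))) + ε := by positivity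

theorem truncWeight_pos {ε : ℝ} (hε : 0 < ε) (s : ℝ) (x : E n) : 0 < truncWeight ε s x :=
  inv_pos.2 (truncWeight_denom_pos hε s x)

theorem truncWeight_le_inv {ε : ℝ} (hε : 0 < ε) (s : ℝ) (x : E n) : truncWeight ε s x ≤ ε⁻¹ :=
  inv_anti₀ hε (by linarith [Real.exp_pos (-(s * Real.log (1 + ‖x‖ ^ 2)))])

theorem truncWeight_le_exp {ε : ℝ} (hε : 0 < ε) (s : ℝ) (x : E n) :
    truncWeight ε s x ≤ Real.exp (s * Real.log (1 + ‖x‖ ^ 2)) := by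
  have h := inv_anti₀ (Real.exp_pos (-(s * Real.log (1 + ‖x‖ ^ 2))))
    (by linarith : Real.exp (-(s * Real.log (1 + ‖x‖ ^ 2))) ≤
      Real.exp (-(s * Real.log (1 + ‖x‖ ^ 2))) + ε)
  rwa [← Real.exp_neg, neg_neg] at h

theorem exp_le_two_mul_truncWeight {ε s : ℝ} (hε : 0 < ε) {x : E n}
    (h : ε ≤ Real.exp (-(s * Real.log (1 + ‖x‖ ^ 2)))) :
    Real.exp (s * Real.log (1 + ‖x‖ ^ 2)) ≤ 2 * truncWeight ε s x := by
  have h1 : Real.exp (s * Real.log (1 + ‖x‖ ^ 2)) =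
      2 * (Real.exp (-(s * Real.log (1 + ‖x‖ ^ 2))) + Real.exp (-(s * Real.log (1 + ‖x‖ ^ 2))))⁻¹ := by
    rw [← two_mul, mul_inv, ← Real.exp_neg, neg_neg]
    ring
  rw [h1]
  refine mul_le_mul_of_nonneg_left (inv_anti₀ (truncWeight_denom_pos hε s x) ?_) zero_le_two
  linarith

theorem contDiff_truncWeight {ε : ℝ} (hε : 0 < ε) (s : ℝ) :
    ContDiff ℝ 1 (truncWeight ε s : E n → ℝ) := by
  refine ContDiff.inv ?_ fun x => (truncWeight_denom_pos hε s x).ne'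
  exact ((contDiff_const.mul (contDiff_log_one_add_norm_sq (m := 1))).neg.exp).add contDiff_const

theorem fderiv_truncWeight_self_nonneg {ε s : ℝ} (hε : 0 < ε) (hs : 0 ≤ s) (x : E n) :
    0 ≤ fderiv ℝ (truncWeight ε s) x x := by
  have h1 : HasFDerivAt (fun x : E n => Real.exp (-(s * Real.log (1 + ‖x‖ ^ 2))) + ε)
      (Real.exp (-(s * Real.log (1 + ‖x‖ ^ 2))) • -(s • (2 / (1 + ‖x‖ ^ 2)) • innerSL ℝ x)) x :=
    ((hasFDerivAt_log_one_add_norm_sq x).const_mul s).fun_neg.exp.add_const ε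
  have h2 := (hasDerivAt_inv (truncWeight_denom_pos hε s x).ne').comp_hasFDerivAt x h1
  have h3 : fderiv ℝ (truncWeight ε s) x x = _ := congrArg (fun T => T x) h2.fderiv
  rw [h3]
  simp only [_root_.smul_apply, _root_.neg_apply, innerSL_apply_apply,
    real_inner_self_eq_norm_sq, smul_eq_mul]
  have h4 : 0 < 1 + ‖x‖ ^ 2 := one_add_norm_sq_pos x
  rw [neg_mul, ← mul_neg, mul_neg _ (s * _), neg_neg]
  have := Real.exp_pos (-(s * Real.log (1 + ‖x‖ ^ 2)))
  positivity

/-- Expand `∫ div (f² Y x) = 0` for `Y` the product of the inner step, the outer step and the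
truncated weight. The radial derivatives of the inner step and of the weight are nonnegative and can
be dropped. That of the outer step is at least `-2Cε`, and it is multiplied by a weight at most
`ε⁻¹`, so it costs `2C` whatever `ε` is. The truncation can thus be removed later without knowing in
advance that the weighted norm of `f` is finite. -/
theorem hardy_truncated (hn : 1 ≤ n) {q : ℝ → ℝ} (hq : ContDiffOn ℝ 1 q (Ici 0))
    (hq' : ∀ r, 0 ≤ r → 0 < derivWithin q (Ici 0) r) {A : ℝ} (hA : q 0 < A) {C : ℝ}
    (hC : ∀ s, ‖stepDeriv s‖ ≤ C) {s : ℝ} (hs : 0 ≤ s) {ε : ℝ} (hε : 0 < ε)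
    {f : E n → ℝ} {G : E n → E n} (hfG : HasWeakGradient f G) (hf : MemLp f 2 volume)
    (hG : MemLp G 2 volume) :
    ∫ x, radialStep q A x * (logCutoff ε 2 x * truncWeight ε s x) * ‖f x‖ ^ 2 ≤
      4 * C * (∫ x, ‖f x‖ ^ 2) +
      4 * ∫ x, radialStep q A x * logCutoff ε 2 x *
        Real.exp ((s + 1) * Real.log (1 + ‖x‖ ^ 2)) * ‖G x‖ ^ 2 := by
  have hC0 : 0 ≤ C := (norm_nonneg _).trans (hC 0)
  set Y : E n → ℝ := fun x => radialStep q A x * (logCutoff ε 2 x * truncWeight ε s x) with hYdef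
  have hZ : ContDiff ℝ 1 fun x : E n => logCutoff ε 2 x * truncWeight ε s x :=
    (contDiff_logCutoff ε 2 (m := 1)).mul (contDiff_truncWeight hε s)
  have hζ : ContDiff ℝ 1 (radialStep q A : E n → ℝ) := contDiff_radialStep hq hA
  have hY : ContDiff ℝ 1 Y := hζ.mul hZ
  have hY' : HasCompactSupport Y := (hasCompactSupport_logCutoff hε 2).mul_right.mul_left
  obtain ⟨hint, hzero⟩ := integral_radial_field hfG hf hG hY hY'
  have hY0 : ∀ x, 0 ≤ Y x := fun x => mul_nonneg (radialStep_nonneg _ _ _)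
    (mul_nonneg (logCutoff_nonneg _ _ _) (truncWeight_pos hε s x).le)
  have hfdY : ∀ x, -(2 * C) ≤ fderiv ℝ Y x x := by
    intro x
    have hr : ‖x‖ ^ 2 / (1 + ‖x‖ ^ 2) ≤ 1 := by
      rw [div_le_one (one_add_norm_sq_pos x)]
      linarith
    have hr0 : 0 ≤ ‖x‖ ^ 2 / (1 + ‖x‖ ^ 2) := by positivity
    have hη : -(2 * C * ε) ≤ fderiv ℝ (logCutoff ε 2) x x := by
      rw [(hasFDerivAt_logCutoff ε 2 x).fderiv]
      simp only [_root_.smul_apply, innerSL_apply_apply,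
        real_inner_self_eq_norm_sq, smul_eq_mul]
      have h1 := (le_abs_self _).trans (hC (2 - ε * Real.log (1 + ‖x‖ ^ 2)))
      have h2 := stepDeriv_nonneg (2 - ε * Real.log (1 + ‖x‖ ^ 2))
      have h3 : stepDeriv (2 - ε * Real.log (1 + ‖x‖ ^ 2)) * (‖x‖ ^ 2 / (1 + ‖x‖ ^ 2)) ≤ C * 1 :=
        mul_le_mul h1 hr hr0 hC0
      calc -(2 * C * ε) = -(C * 1 * (2 * ε)) := by ring
        _ ≤ -(stepDeriv (2 - ε * Real.log (1 + ‖x‖ ^ 2)) * (‖x‖ ^ 2 / (1 + ‖x‖ ^ 2)) *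
            (2 * ε)) := by gcongr
        _ = _ := by ring
    have hζx : 0 ≤ fderiv ℝ (radialStep q A) x x := by
      rw [(hasFDerivAt_radialStep hq hA x).fderiv]
      simp only [_root_.smul_apply, innerSL_apply_apply,
        real_inner_self_eq_norm_sq, smul_eq_mul]
      have := stepDeriv_nonneg (q ‖x‖ - A)
      have := (hq' ‖x‖ (norm_nonneg x)).le
      positivity
    have hw := fderiv_truncWeight_self_nonneg (x := x) hε hs
    have h1 : fderiv ℝ Y x x = radialStep q A x * (logCutoff ε 2 x * fderiv ℝ (truncWeight ε s) x x +
        truncWeight ε s x * fderiv ℝ (logCutoff ε 2) x x) +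
        logCutoff ε 2 x * truncWeight ε s x * fderiv ℝ (radialStep q A) x x := by
      rw [hYdef, fderiv_fun_mul (hζ.differentiable (by simp) x) (hZ.differentiable (by simp) x),
        fderiv_fun_mul ((contDiff_logCutoff ε 2 (m := 1)).differentiable (by simp) x)
        ((contDiff_truncWeight hε s).differentiable (by simp) x)]
      simp [mul_add]
    rw [h1]
    have e1 : 0 ≤ radialStep q A x * (logCutoff ε 2 x * fderiv ℝ (truncWeight ε s) x x) :=
      mul_nonneg (radialStep_nonneg _ _ _) (mul_nonneg (logCutoff_nonneg _ _ _) hw)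
    have e2 : 0 ≤ logCutoff ε 2 x * truncWeight ε s x * fderiv ℝ (radialStep q A) x x :=
      mul_nonneg (mul_nonneg (logCutoff_nonneg _ _ _) (truncWeight_pos hε s x).le) hζx
    have e3 : radialStep q A x * truncWeight ε s x * (2 * C * ε) ≤ 1 * ε⁻¹ * (2 * C * ε) := by
      have := truncWeight_le_inv hε s x
      have := radialStep_le_one q A x
      have := (truncWeight_pos hε s x).le
      gcongr
    have e4 : 1 * ε⁻¹ * (2 * C * ε) = 2 * C := by field_simp
    have e5 : radialStep q A x * truncWeight ε s x * (-(2 * C * ε)) ≤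
        radialStep q A x * truncWeight ε s x * fderiv ℝ (logCutoff ε 2) x x :=
      mul_le_mul_of_nonneg_left hη (mul_nonneg (radialStep_nonneg _ _ _)
        (truncWeight_pos hε s x).le)
    nlinarith
  set W : E n → ℝ := fun x => radialStep q A x * logCutoff ε 2 x *
    Real.exp ((s + 1) * Real.log (1 + ‖x‖ ^ 2)) with hWdef
  have hWc : Continuous W := (hζ.continuous.mul (contDiff_logCutoff ε 2 (m := 1)).continuous).mul
    (continuous_const.mul (contDiff_log_one_add_norm_sq (m := 1)).continuous).rexp
  have hWs : HasCompactSupport W := (hasCompactSupport_logCutoff hε 2).mul_left.mul_right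
  have hYW : ∀ x, Y x * ‖x‖ ^ 2 ≤ W x := by
    intro x
    have h1 := truncWeight_le_exp hε s x
    have h2 : Real.exp ((s + 1) * Real.log (1 + ‖x‖ ^ 2)) =
        Real.exp (s * Real.log (1 + ‖x‖ ^ 2)) * (1 + ‖x‖ ^ 2) := by
      rw [add_mul, Real.exp_add, one_mul, Real.exp_log (one_add_norm_sq_pos x)]
    have h3 : truncWeight ε s x * ‖x‖ ^ 2 ≤ Real.exp (s * Real.log (1 + ‖x‖ ^ 2)) * (1 + ‖x‖ ^ 2) := by
      have := (truncWeight_pos hε s x).le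
      gcongr
      linarith
    rw [hWdef, hYdef]
    simp only
    rw [h2]
    calc _ = radialStep q A x * logCutoff ε 2 x * (truncWeight ε s x * ‖x‖ ^ 2) := by ring
      _ ≤ _ := mul_le_mul_of_nonneg_left h3
        (mul_nonneg (radialStep_nonneg _ _ _) (logCutoff_nonneg _ _ _))
  have i1 : Integrable fun x => Y x * ‖f x‖ ^ 2 :=
    integrable_compact_mul_sq_norm hY.continuous hY' hf
  have i2 : Integrable fun x => ‖f x‖ ^ 2 := hf.integrable_norm_pow (by norm_num)
  have i3 : Integrable fun x => W x * ‖G x‖ ^ 2 := integrable_compact_mul_sq_norm hWc hWs hG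
  have hmono : ∫ x, (1 / 2 * (Y x * ‖f x‖ ^ 2) - 2 * C * ‖f x‖ ^ 2 - 2 * (W x * ‖G x‖ ^ 2)) ≤ 0 := by
    rw [← hzero]
    refine integral_mono (((i1.const_mul _).sub (i2.const_mul _)).sub (i3.const_mul _)) hint
      fun x => ?_
    simp only [Real.norm_eq_abs, sq_abs]
    have hin : -(‖G x‖ * ‖x‖) ≤ inner ℝ (G x) x ∧ inner ℝ (G x) x ≤ ‖G x‖ * ‖x‖ :=
      abs_le.1 (abs_real_inner_le_norm _ _)
    -- Young's inequality, balanced so that half of `Y f²` survives. The term `n Y` coming from `div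
    -- x = n` supplies a full `Y f²` because `n ≥ 1`.
    have h1 : -(1 / 2 * f x ^ 2 + 2 * (‖x‖ ^ 2 * ‖G x‖ ^ 2)) ≤ 2 * (f x * inner ℝ (G x) x) := by
      have : (inner ℝ (G x) x) ^ 2 ≤ (‖G x‖ * ‖x‖) ^ 2 := sq_le_sq' hin.1 hin.2
      nlinarith [sq_nonneg (f x + 2 * inner ℝ (G x) x)]
    have h2 := mul_le_mul_of_nonneg_left h1 (hY0 x)
    have h3 := mul_le_mul_of_nonneg_right (hYW x) (sq_nonneg ‖G x‖)
    have h4 : Y x ≤ n * Y x := by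
      have : (1 : ℝ) ≤ n := by exact_mod_cast hn
      nlinarith [hY0 x]
    have h5 : f x ^ 2 * (Y x - 2 * C) ≤ f x ^ 2 * (n * Y x + fderiv ℝ Y x x) :=
      mul_le_mul_of_nonneg_left (by linarith [hfdY x]) (sq_nonneg _)
    nlinarith
  have hsub : Integrable fun x => 1 / 2 * (Y x * ‖f x‖ ^ 2) - 2 * C * ‖f x‖ ^ 2 :=
    (i1.const_mul _).sub (i2.const_mul _)
  rw [integral_sub hsub (i3.const_mul _), integral_sub (i1.const_mul _) (i2.const_mul _),
    integral_const_mul, integral_const_mul, integral_const_mul] at hmono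
  linarith

/-! ### The equation integrated in time -/

theorem continuous_toL2 : Continuous (toL2 (n := n)) := continuous_fst.comp continuous_subtype_val

theorem continuous_grad : Continuous (grad (n := n)) := continuous_snd.comp continuous_subtype_val

/-- The path `u`, extended by its initial value to nonpositive times. -/
def extendPath (u₀ : H1 n) (u : ℝ → H1 n) (t : ℝ) : H1 n := if t ≤ 0 then u₀ else u t

theorem extendPath_of_pos {u₀ : H1 n} {u : ℝ → H1 n} {t : ℝ} (ht : 0 < t) :
    extendPath u₀ u t = u t := if_neg (not_le.2 ht)

theorem extendPath_zero {u₀ : H1 n} {u : ℝ → H1 n} : extendPath u₀ u 0 = u₀ := if_pos le_rfl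

theorem extendPath_eventuallyEq {u₀ : H1 n} {u : ℝ → H1 n} {t : ℝ} (ht : 0 < t) :
    extendPath u₀ u =ᶠ[𝓝 t] u := by
  filter_upwards [lt_mem_nhds ht] with s hs using extendPath_of_pos hs

theorem continuous_extendPath {u₀ : H1 n} {u : ℝ → H1 n} (hu : ContinuousOn u (Ioi 0))
    (h0 : Tendsto u (𝓝[>] 0) (𝓝 u₀)) : Continuous (extendPath u₀ u) := by
  rw [continuous_iff_continuousAt]
  intro t
  rcases lt_trichotomy t 0 with ht | rfl | ht
  · refine (continuousAt_const (y := u₀)).congr ?_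
    filter_upwards [gt_mem_nhds ht] with s hs using (if_pos hs.le).symm
  · rw [continuousAt_iff_continuous_left'_right']
    constructor
    · refine ContinuousWithinAt.congr (continuousWithinAt_const (b := u₀)) (fun s hs => ?_)
        extendPath_zero
      exact if_pos (le_of_lt hs)
    · rw [ContinuousWithinAt, extendPath_zero]
      refine h0.congr' ?_
      filter_upwards [self_mem_nhdsWithin] with s hs using (extendPath_of_pos hs).symm
  · exact (hu.continuousAt (Ioi_mem_nhds ht)).congr (extendPath_eventuallyEq ht).symm

/-- The time integral `∫₀ᵗ ∇u ds`. -/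
def gradIntegral (u₀ : H1 n) (u : ℝ → H1 n) (t : ℝ) : L2V n :=
  ∫ s in (0 : ℝ)..t, grad (extendPath u₀ u s)

theorem hasDerivAt_gradIntegral {u₀ : H1 n} {u : ℝ → H1 n} (hu : ContinuousOn u (Ioi 0))
    (h0 : Tendsto u (𝓝[>] 0) (𝓝 u₀)) (t : ℝ) :
    HasDerivAt (gradIntegral u₀ u) (grad (extendPath u₀ u t)) t :=
  ((continuous_grad.comp (continuous_extendPath hu h0)).integral_hasStrictDerivAt 0 t).hasDerivAt

theorem gradIntegral_zero (u₀ : H1 n) (u : ℝ → H1 n) : gradIntegral u₀ u 0 = 0 :=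
  intervalIntegral.integral_same

theorem exists_clm_integral_mul_mul {w φ : E n → ℝ} (hw : Continuous w) (hφ : Continuous φ)
    (hφ' : HasCompactSupport φ) :
    ∃ T : L2 n →L[ℝ] ℝ, ∀ v : L2 n, T v = ∫ x, w x * v x * φ x := by
  have hm : MemLp (fun x => w x * φ x) 2 (volume : Measure (E n)) :=
    (hw.mul hφ).memLp_of_hasCompactSupport hφ'.mul_left
  refine ⟨innerSL ℝ (hm.toLp _), fun v => ?_⟩
  rw [innerSL_apply_apply, L2.inner_def]
  refine integral_congr_ae ?_
  filter_upwards [hm.coeFn_toLp] with x hx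
  rw [hx]
  simp
  ring

theorem exists_clm_integral_mul_fderiv {b φ : E n → ℝ} (hb : Continuous b)
    (hφ : ContDiff ℝ 1 φ) (hφ' : HasCompactSupport φ) :
    ∃ T : L2V n →L[ℝ] ℝ, ∀ v : L2V n, T v = ∫ x, b x * fderiv ℝ φ x (v x) := by
  have hm : MemLp (fun x => b x • gradient φ x) 2 (volume : Measure (E n)) := by
    have hc : Continuous (gradient φ) :=
      (InnerProductSpace.toDual ℝ (E n)).symm.continuous.comp (hφ.continuous_fderiv (by simp))
    have hs : HasCompactSupport (gradient φ) := (hφ'.fderiv (𝕜 := ℝ)).comp_left (map_zero _)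
    exact (hb.smul hc).memLp_of_hasCompactSupport hs.smul_left
  refine ⟨innerSL ℝ (hm.toLp _), fun v => ?_⟩
  rw [innerSL_apply_apply, L2.inner_def]
  refine integral_congr_ae ?_
  filter_upwards [hm.coeFn_toLp] with x hx
  rw [hx, real_inner_smul_left]
  simp [gradient]

theorem IsSolution.hasDerivAt_toL2 {a b c : E n → ℝ} {h : ℝ → L2 n} {u₀ : H1 n} {u₁ : L2 n}
    {u : ℝ → H1 n} (hu : IsSolution a b c h u₀ u₁ u) {t : ℝ} (ht : 0 < t) :
    HasDerivAt (fun s => toL2 (extendPath u₀ u s)) (timeDeriv u t) t := by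
  have h1 : DifferentiableAt ℝ (fun s => toL2 (u s)) t :=
    (hu.contDiffOn.differentiableOn (by simp)).differentiableAt (Ioi_mem_nhds ht)
  refine h1.hasDerivAt.congr_of_eventuallyEq ?_
  filter_upwards [extendPath_eventuallyEq (u₀ := u₀) (u := u) ht] with s hs
  rw [hs]

/-- Testing the equation with a fixed `φ` gives the time derivative of the left side. The source
does not contribute at times `s ≤ t`, because the exterior regions shrink with time; the limit at
time `0` vanishes because `φ` lives in `|x| > R`. -/
theorem IsSolution.integrated_equation {a b c : E n → ℝ} (ha : Continuous a) (hb : Continuous b)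
    (hc : Continuous c) {h : ℝ → L2 n} {u₀ : H1 n} {u₁ : L2 n}
    {u : ℝ → H1 n} (hu : IsSolution a b c h u₀ u₁ u) {q : ℝ → ℝ} (hq : StrictMonoOn q (Ici 0))
    {R : ℝ} (hR : 0 ≤ R)
    (hh : ∀ t : ℝ, 0 < t →
      ∀ᵐ x ∂(volume : Measure (E n)), x ∈ exterior n q R t → h t x = 0)
    (hu₀ : ∀ᵐ x ∂(volume : Measure (E n)), R < ‖x‖ → toL2 u₀ x = 0)
    (hu₁ : ∀ᵐ x ∂(volume : Measure (E n)), R < ‖x‖ → u₁ x = 0)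
    {t : ℝ} (ht : 0 < t) {φ : E n → ℝ} (hφ : IsTestFunction φ)
    (hφt : tsupport φ ⊆ exterior n q R t) :
    (∫ x, c x * timeDeriv u t x * φ x) + (∫ x, b x * fderiv ℝ φ x (gradIntegral u₀ u t x)) +
      ∫ x, a x * toL2 (u t) x * φ x = 0 := by
  have hφ1 : ContDiff ℝ 1 φ := hφ.1.of_le (by simp)
  have hzero : ∀ x, x ∉ exterior n q R t → φ x = 0 := fun x hx =>
    image_eq_zero_of_notMem_tsupport fun hc => hx (hφt hc)
  obtain ⟨Ta, hTa⟩ := exists_clm_integral_mul_mul ha hφ1.continuous hφ.2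
  obtain ⟨Tc, hTc⟩ := exists_clm_integral_mul_mul hc hφ1.continuous hφ.2
  obtain ⟨Tb, hTb⟩ := exists_clm_integral_mul_fderiv hb hφ1 hφ.2
  set J : ℝ → ℝ := fun s => (∫ x, c x * timeDeriv u s x * φ x) + Tb (gradIntegral u₀ u s) +
    Ta (toL2 (extendPath u₀ u s)) with hJ
  have hderiv : ∀ s, 0 < s → s ≤ t → HasDerivAt J 0 s := by
    intro s hs hst
    have h1 := hu.equation φ hφ s hs
    have h2 : HasDerivAt (fun s => Tb (gradIntegral u₀ u s)) (Tb (grad (u s))) s := by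
      have := Tb.hasFDerivAt.comp_hasDerivAt s
        (hasDerivAt_gradIntegral hu.continuousOn hu.initial s)
      rwa [extendPath_of_pos hs] at this
    have h3 : HasDerivAt (fun s => Ta (toL2 (extendPath u₀ u s))) (Ta (timeDeriv u s)) s :=
      Ta.hasFDerivAt.comp_hasDerivAt s (hu.hasDerivAt_toL2 hs)
    refine ((h1.add h2).add h3).congr_deriv ?_
    have h4 : ∫ x, h s x * φ x = 0 := by
      rw [← integral_zero (E n) ℝ]
      refine integral_congr_ae ?_
      filter_upwards [hh s hs] with x hx
      by_cases hx' : x ∈ exterior n q R t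
      · rw [hx (exterior_anti q R hst hx'), zero_mul]
      · rw [hzero x hx', mul_zero]
    rw [hTb, hTa, h4]
    ring
  have hconst : ∀ r, 0 < r → r ≤ t → J r = J t := by
    intro r hr hrt
    refine (constant_of_has_deriv_right_zero (a := r) (b := t)
      (fun s hs => (hderiv s (hr.trans_le hs.1) hs.2).continuousAt.continuousWithinAt)
      (fun s hs => (hderiv s (hr.trans_le hs.1) hs.2.le).hasDerivWithinAt) t ⟨hrt, le_rfl⟩).symm
  have hext : ∀ x, φ x ≠ 0 → R < ‖x‖ := fun x hx =>
    lt_norm_of_mem_exterior hq hR ht.le (by_contra fun hc => hx (hzero x hc))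
  have hlim : Tendsto J (𝓝[>] 0) (𝓝 (Tc u₁ + Tb 0 + Ta (toL2 u₀))) := by
    refine Tendsto.add (Tendsto.add ?_ ?_) ?_
    · simp only [← hTc]
      exact (Tc.continuous.tendsto _).comp hu.initial_deriv
    · have h1 := (hasDerivAt_gradIntegral hu.continuousOn hu.initial 0).continuousAt
      rw [ContinuousAt, gradIntegral_zero] at h1
      exact (Tb.continuous.tendsto _).comp (h1.mono_left nhdsWithin_le_nhds)
    · have h1 := ((Ta.continuous.comp continuous_toL2).comp
        (continuous_extendPath hu.continuousOn hu.initial)).tendsto 0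
      simp only [Function.comp_def, extendPath_zero] at h1
      exact h1.mono_left nhdsWithin_le_nhds
  have hvanish : ∀ (w : E n → ℝ) (v : L2 n),
      (∀ᵐ x ∂(volume : Measure (E n)), R < ‖x‖ → v x = 0) → ∫ x, w x * v x * φ x = 0 := by
    intro w v hv
    rw [← integral_zero (E n) ℝ]
    refine integral_congr_ae ?_
    filter_upwards [hv] with x hx
    by_cases hx' : φ x = 0
    · rw [hx', mul_zero]
    · rw [hx (hext x hx'), mul_zero, zero_mul]
  rw [hTc, hvanish _ _ hu₁, hTa, hvanish _ _ hu₀, map_zero, add_zero, add_zero] at hlim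
  have hJt : J t = 0 := by
    refine tendsto_nhds_unique (tendsto_const_nhds.congr' ?_) hlim
    filter_upwards [Ioc_mem_nhdsGT ht] with r hr using (hconst r hr.1 hr.2).symm
  rw [← hJt, hJ]
  simp only [hTa, hTb, extendPath_of_pos ht]

/-! ### The localised energy -/

theorem LocallyL2.integrable_fderiv_apply {B : E n → E n} (hB : LocallyL2 B) {φ : E n → ℝ}
    (hφ : ContDiff ℝ 1 φ) (hφ' : HasCompactSupport φ) :
    Integrable fun x => fderiv ℝ φ x (B x) := by
  have h : (fun x => fderiv ℝ φ x (B x)) = fun x => ∑ j, B x j * fderiv ℝ φ x (stdVec j) := by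
    ext x
    rw [clm_apply_eq_sum]
    simp only [mul_comm]
  rw [h]
  exact integrable_finsetSum _ fun j _ =>
    (hB.coord j).integrable_mul (continuous_fderiv_apply hφ _) (hφ'.fderiv_apply (𝕜 := ℝ) _)

/-- A moving cutoff, equal to `1` well inside the exterior region. -/
def cutoff (q : ℝ → ℝ) (A ε K t : ℝ) (x : E n) : ℝ :=
  radialStep q (t + A) x * logCutoff ε (2 - ε * K * t) x

/-- The part of minus the time derivative of `cutoff` due to the inner cutoff. -/
def cutoffInner (q : ℝ → ℝ) (A ε K t : ℝ) (x : E n) : ℝ :=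
  stepDeriv (q ‖x‖ - (t + A)) * logCutoff ε (2 - ε * K * t) x

/-- The derivative of `cutoff` with respect to the argument of the outer step. -/
def cutoffOuter (q : ℝ → ℝ) (A ε K t : ℝ) (x : E n) : ℝ :=
  radialStep q (t + A) x * stepDeriv (2 - ε * K * t - ε * Real.log (1 + ‖x‖ ^ 2))

theorem logCutoff_three_eq_one {ε K t : ℝ} (hε : 0 < ε) (hK : 0 ≤ K) (ht : 0 ≤ t) {x : E n}
    (h : 0 ≤ 2 - ε * K * t - ε * Real.log (1 + ‖x‖ ^ 2)) : logCutoff ε 3 x = 1 := by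
  have : 0 ≤ ε * K * t := by positivity
  exact logCutoff_eq_one (by linarith)

/-- The factor `w` may be unbounded, so it is first multiplied by the fixed compactly supported
`logCutoff ε 3`. For `t ≥ 0` this equals one wherever the argument of the moving outer step is
nonnegative, hence it leaves the weight and its time derivative unchanged. -/
theorem exists_movingWeight {q : ℝ → ℝ} (hq : ContinuousOn q (Ici 0)) (A : ℝ) {ε K : ℝ}
    (hε : 0 < ε) (hK : 0 ≤ K) {w : E n → ℝ} (hw : Continuous w) :
    ∃ k k' : ℝ → E n →ᵇ ℝ, (∀ t, HasDerivAt k (k' t) t) ∧ ∀ t, 0 ≤ t → ∀ x,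
      k t x = w x * cutoff q A ε K t x ∧
      k' t x = -(w x * (cutoffInner q A ε K t x + ε * K * cutoffOuter q A ε K t x)) := by
  have hm : Continuous fun x : E n => w x * logCutoff ε 3 x :=
    hw.mul (contDiff_logCutoff ε 3 (m := 1)).continuous
  have hm' : HasCompactSupport fun x : E n => w x * logCutoff ε 3 x :=
    (hasCompactSupport_logCutoff hε 3).mul_left
  obtain ⟨M, hM⟩ := hm'.exists_bound_of_continuous hm
  let m : E n →ᵇ ℝ := .ofNormedAddCommGroup _ hm M hM
  let p₁ : C(E n, ℝ) := ⟨fun x => q ‖x‖ - A, (continuous_comp_norm hq).sub continuous_const⟩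
  let p₂ : C(E n, ℝ) := ⟨fun x => 2 - ε * Real.log (1 + ‖x‖ ^ 2),
    continuous_const.sub (continuous_const.mul
      (contDiff_log_one_add_norm_sq (m := 1)).continuous)⟩
  refine ⟨fun t => m * (translate stepBCF p₁ (-1) t * translate stepBCF p₂ (-(ε * K)) t),
    fun t => m * (((-1 : ℝ) • translate stepDerivBCF p₁ (-1) t) * translate stepBCF p₂ (-(ε * K)) t
      + translate stepBCF p₁ (-1) t * ((-(ε * K)) • translate stepDerivBCF p₂ (-(ε * K)) t)),
    fun t => ((hasDerivAt_translate p₁ (-1) t).mul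
      (hasDerivAt_translate p₂ (-(ε * K)) t)).const_mul m, fun t ht x => ?_⟩
  have e1 : q ‖x‖ - A + -1 * t = q ‖x‖ - (t + A) := by ring
  have e2 : 2 - ε * Real.log (1 + ‖x‖ ^ 2) + -(ε * K) * t =
      2 - ε * K * t - ε * Real.log (1 + ‖x‖ ^ 2) := by ring
  simp only [BoundedContinuousFunction.coe_mul, BoundedContinuousFunction.coe_add,
    BoundedContinuousFunction.coe_smul, Pi.mul_apply, Pi.add_apply, smul_eq_mul,
    translate_step_apply, translate_stepDeriv_apply, m, p₁, p₂, ContinuousMap.coe_mk,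
    BoundedContinuousFunction.coe_ofNormedAddCommGroup, e1, e2, cutoff, cutoffInner, cutoffOuter,
    radialStep]
  by_cases hx : 0 ≤ 2 - ε * K * t - ε * Real.log (1 + ‖x‖ ^ 2)
  · rw [logCutoff_three_eq_one hε hK ht hx]
    simp only [logCutoff]
    constructor <;> ring
  · rw [not_le] at hx
    have h1 : logCutoff ε (2 - ε * K * t) x = 0 := Real.smoothTransition.zero_of_nonpos hx.le
    simp only [logCutoff] at h1
    simp only [logCutoff, h1, stepDeriv_eq_zero_of_neg hx]
    constructor <;> ring

/-- Hypotheses on the coefficients and on the phase `q`. -/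
structure Admissible (a b c : E n → ℝ) (q : ℝ → ℝ) : Prop where
  contA : Continuous a
  contB : Continuous b
  contC : Continuous c
  nonnegA : ∀ x, 0 ≤ a x
  posB : ∀ x, 0 < b x
  posC : ∀ x, 0 < c x
  contDiffOn : ContDiffOn ℝ 1 q (Ici 0)
  deriv_pos : ∀ r, 0 ≤ r → 0 < derivWithin q (Ici 0) r
  speed : ∀ x, b x * derivWithin q (Ici 0) ‖x‖ ^ 2 ≤ c x

theorem Admissible.strictMonoOn {a b c : E n → ℝ} {q : ℝ → ℝ} (hA : Admissible a b c q) :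
    StrictMonoOn q (Ici 0) :=
  strictMonoOn_of_derivWithin_pos hA.contDiffOn.continuousOn hA.deriv_pos

theorem contDiff_cutoff {q : ℝ → ℝ} (hq : ContDiffOn ℝ 1 q (Ici 0)) {A ε K t : ℝ}
    (hA : q 0 < t + A) : ContDiff ℝ 1 (cutoff q A ε K t : E n → ℝ) :=
  (contDiff_radialStep hq hA).mul (contDiff_logCutoff _ _ (m := 1))

theorem hasCompactSupport_cutoff (q : ℝ → ℝ) (A K t : ℝ) {ε : ℝ} (hε : 0 < ε) :
    HasCompactSupport (cutoff q A ε K t : E n → ℝ) :=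
  (hasCompactSupport_logCutoff hε _).mul_left

theorem cutoff_nonneg (q : ℝ → ℝ) (A ε K t : ℝ) (x : E n) : 0 ≤ cutoff q A ε K t x :=
  mul_nonneg (radialStep_nonneg _ _ _) (logCutoff_nonneg _ _ _)

theorem abs_fderiv_cutoff_le {q : ℝ → ℝ} (hq : ContDiffOn ℝ 1 q (Ici 0))
    (hq' : ∀ r, 0 ≤ r → 0 < derivWithin q (Ici 0) r) {A ε K t : ℝ} (hε : 0 < ε)
    (hA : q 0 < t + A) (x v : E n) :
    |fderiv ℝ (cutoff q A ε K t) x v| ≤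
      cutoffInner q A ε K t x * derivWithin q (Ici 0) ‖x‖ * ‖v‖ +
      ε * cutoffOuter q A ε K t x * (2 * ‖x‖ / (1 + ‖x‖ ^ 2)) * ‖v‖ := by
  have h1 : HasFDerivAt (cutoff q A ε K t) _ x :=
    (hasFDerivAt_radialStep hq hA x).mul (hasFDerivAt_logCutoff ε (2 - ε * K * t) x)
  rw [h1.fderiv]
  simp only [_root_.add_apply, _root_.smul_apply, innerSL_apply_apply, smul_eq_mul]
  have hin : |inner ℝ x v| ≤ ‖x‖ * ‖v‖ := abs_real_inner_le_norm x v
  have hr := radialStep_nonneg q (t + A) x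
  have hl := logCutoff_nonneg ε (2 - ε * K * t) x
  have hs1 := stepDeriv_nonneg (q ‖x‖ - (t + A))
  have hs2 := stepDeriv_nonneg (2 - ε * K * t - ε * Real.log (1 + ‖x‖ ^ 2))
  have hd := (hq' ‖x‖ (norm_nonneg x)).le
  -- Only an inequality, since the product is `0` at the origin.
  have hx : ‖x‖⁻¹ * ‖x‖ ≤ 1 := inv_mul_le_one
  refine (abs_add_le _ _).trans ?_
  rw [add_comm]
  refine add_le_add ?_ ?_
  · rw [abs_mul, abs_mul, abs_of_nonneg hl, abs_of_nonneg
      (by positivity : 0 ≤ stepDeriv (q ‖x‖ - (t + A)) * derivWithin q (Ici 0) ‖x‖ * ‖x‖⁻¹)]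
    calc _ ≤ logCutoff ε (2 - ε * K * t) x *
        (stepDeriv (q ‖x‖ - (t + A)) * derivWithin q (Ici 0) ‖x‖ * ‖x‖⁻¹ * (‖x‖ * ‖v‖)) := by gcongr
      _ = logCutoff ε (2 - ε * K * t) x * stepDeriv (q ‖x‖ - (t + A)) *
        derivWithin q (Ici 0) ‖x‖ * ‖v‖ * (‖x‖⁻¹ * ‖x‖) := by ring
      _ ≤ logCutoff ε (2 - ε * K * t) x * stepDeriv (q ‖x‖ - (t + A)) *
        derivWithin q (Ici 0) ‖x‖ * ‖v‖ * 1 := by gcongr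
      _ = _ := by rw [cutoffInner]; ring
  · rw [abs_mul, abs_mul, abs_neg, abs_of_nonneg hr, abs_of_nonneg
      (by positivity : 0 ≤ stepDeriv (2 - ε * K * t - ε * Real.log (1 + ‖x‖ ^ 2)) * ε *
        (2 / (1 + ‖x‖ ^ 2)))]
    calc _ ≤ radialStep q (t + A) x *
        (stepDeriv (2 - ε * K * t - ε * Real.log (1 + ‖x‖ ^ 2)) * ε * (2 / (1 + ‖x‖ ^ 2)) *
          (‖x‖ * ‖v‖)) := by gcongr
      _ = _ := by rw [cutoffOuter]; ring

/-- Twice the localised energy of the time integral of `u`. -/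
def localEnergy (b c : E n → ℝ) (q : ℝ → ℝ) (A ε K : ℝ) (u₀ : H1 n) (u : ℝ → H1 n) (t : ℝ) : ℝ :=
  (∫ x, c x * cutoff q A ε K t x * ‖toL2 (extendPath u₀ u t) x‖ ^ 2) +
    ∫ x, b x * cutoff q A ε K t x * ‖gradIntegral u₀ u t x‖ ^ 2

/-- The density of the flux of the localised energy through the outer cutoff. -/
def outerFlux (b c : E n → ℝ) (q : ℝ → ℝ) (A ε K : ℝ) (u₀ : H1 n) (u : ℝ → H1 n) (t : ℝ)
    (x : E n) : ℝ :=
  ε * cutoffOuter q A ε K t x *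
    (4 * b x * (|toL2 (u t) x| * ‖gradIntegral u₀ u t x‖) * (‖x‖ / (1 + ‖x‖ ^ 2)) -
      K * (c x * toL2 (u t) x ^ 2 + b x * ‖gradIntegral u₀ u t x‖ ^ 2))

theorem hasWeakGradient_toL2 (f : H1 n) : HasWeakGradient (toL2 f) (grad f) := f.2

/-- Here `i` and `o` are the inner and outer cutoff densities, `d` is the slope of `q`, and `F`
stands for `∇σ · V`. From `b d² ≤ c` one has `2 b |f| d V ≤ c f² + b V²`, so the inner flux is
absorbed by the inner loss. The damping is dropped and the outer terms are kept as they are. -/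
theorem energy_density_le {a b c σ i o d K ε ρ f V F : ℝ} (ha : 0 ≤ a) (hb : 0 < b)
    (hσ : 0 ≤ σ) (hi : 0 ≤ i) (hs : b * d ^ 2 ≤ c)
    (hF : |F| ≤ i * d * V + ε * o * (2 * ρ) * V) :
    -(c * (i + ε * K * o)) * f ^ 2 + -(b * (i + ε * K * o)) * V ^ 2 - 2 * (a * σ * f ^ 2)
      - 2 * (b * (f * F)) ≤
      ε * o * (4 * b * (|f| * V) * ρ - K * (c * f ^ 2 + b * V ^ 2)) := by
  have h1 : -(b * (f * F)) ≤ b * (|f| * (i * d * V + ε * o * (2 * ρ) * V)) := by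
    have : |f * F| ≤ |f| * (i * d * V + ε * o * (2 * ρ) * V) := by
      rw [abs_mul]
      exact mul_le_mul_of_nonneg_left hF (abs_nonneg f)
    have h2 := neg_le_of_abs_le this
    nlinarith
  have h2 : 2 * (b * (|f| * (d * V))) ≤ c * f ^ 2 + b * V ^ 2 := by
    have e1 : 0 ≤ b * (d * |f| - V) ^ 2 := by positivity
    have e2 : b * d ^ 2 * |f| ^ 2 ≤ c * f ^ 2 := by
      rw [sq_abs]
      exact mul_le_mul_of_nonneg_right hs (sq_nonneg f)
    linarith [show b * (d * |f| - V) ^ 2 =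
      b * d ^ 2 * |f| ^ 2 - 2 * (b * (|f| * (d * V))) + b * V ^ 2 by ring]
  have h3 := mul_le_mul_of_nonneg_left h2 hi
  have h4 : 0 ≤ a * σ * f ^ 2 := by positivity
  nlinarith

theorem continuous_cutoffOuter {q : ℝ → ℝ} (hq : ContinuousOn q (Ici 0)) (A ε K t : ℝ) :
    Continuous (cutoffOuter q A ε K t : E n → ℝ) :=
  (Real.smoothTransition.continuous.comp ((continuous_comp_norm hq).sub continuous_const)).mul
    (contDiff_stepDeriv.continuous.comp (continuous_const.sub (continuous_const.mul
      (contDiff_log_one_add_norm_sq (m := 1)).continuous)))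

theorem hasCompactSupport_cutoffOuter (q : ℝ → ℝ) (A K t : ℝ) {ε : ℝ} (hε : 0 < ε) :
    HasCompactSupport (cutoffOuter q A ε K t : E n → ℝ) := by
  refine (hasCompactSupport_logCutoff hε (3 - ε * K * t)).mono' fun x hx => subset_tsupport _ ?_
  intro h0
  refine hx ?_
  rw [cutoffOuter, stepDeriv_eq_zero_of_nonpos, mul_zero]
  have := Real.smoothTransition.zero_iff_nonpos.1 h0
  linarith

theorem integrable_outerFlux {a b c : E n → ℝ} {q : ℝ → ℝ} (hadm : Admissible a b c q)
    (A K : ℝ) {ε : ℝ} (hε : 0 < ε) (u₀ : H1 n) (u : ℝ → H1 n) (t : ℝ) :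
    Integrable (outerFlux b c q A ε K u₀ u t) := by
  have hc0 := continuous_cutoffOuter (n := n) hadm.contDiffOn.continuousOn A ε K t
  have hs0 := hasCompactSupport_cutoffOuter (n := n) q A K t hε
  have hρ : Continuous fun x : E n => ‖x‖ / (1 + ‖x‖ ^ 2) :=
    continuous_norm.div (by fun_prop) fun x => (one_add_norm_sq_pos x).ne'
  have hu := Lp.memLp (toL2 (u t))
  have hV := Lp.memLp (gradIntegral u₀ u t)
  have i1 : Integrable fun x => cutoffOuter q A ε K t x * (4 * b x * (ε * (‖x‖ / (1 + ‖x‖ ^ 2)))) *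
      (‖toL2 (u t) x‖ * ‖gradIntegral u₀ u t x‖) :=
    integrable_compact_mul_mul
      (hc0.mul ((continuous_const.mul hadm.contB).mul (continuous_const.mul hρ))) hs0.mul_right
      hu.norm hV.norm
  have i2 : Integrable fun x => cutoffOuter q A ε K t x * (ε * K * c x) * ‖toL2 (u t) x‖ ^ 2 :=
    integrable_compact_mul_sq_norm (hc0.mul (continuous_const.mul hadm.contC)) hs0.mul_right hu
  have i3 : Integrable fun x => cutoffOuter q A ε K t x * (ε * K * b x) *
      ‖gradIntegral u₀ u t x‖ ^ 2 :=
    integrable_compact_mul_sq_norm (hc0.mul (continuous_const.mul hadm.contB)) hs0.mul_right hV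
  have hsum : outerFlux b c q A ε K u₀ u t = fun x =>
      cutoffOuter q A ε K t x * (4 * b x * (ε * (‖x‖ / (1 + ‖x‖ ^ 2)))) *
        (‖toL2 (u t) x‖ * ‖gradIntegral u₀ u t x‖) -
      cutoffOuter q A ε K t x * (ε * K * c x) * ‖toL2 (u t) x‖ ^ 2 -
      cutoffOuter q A ε K t x * (ε * K * b x) * ‖gradIntegral u₀ u t x‖ ^ 2 := by
    ext x
    simp only [outerFlux, Real.norm_eq_abs, sq_abs]
    ring
  rw [hsum]
  exact (i1.sub i2).sub i3

theorem cutoffInner_nonneg (q : ℝ → ℝ) (A ε K t : ℝ) (x : E n) : 0 ≤ cutoffInner q A ε K t x :=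
  mul_nonneg (stepDeriv_nonneg _) (logCutoff_nonneg _ _ _)

/-- Differentiation produces `2 ∫ σ (c u u_t + b V · ∇u)` besides the terms with `σ_t`. The
integrated equation tested against `σ u` turns it into `-2 ∫ a σ u² - 2 ∫ b u ∇σ · V`, which
contains neither `u_t` nor `∇u`. -/
theorem exists_hasDerivAt_localEnergy {a b c : E n → ℝ} {q : ℝ → ℝ} (hadm : Admissible a b c q)
    {h : ℝ → L2 n} {u₀ : H1 n} {u₁ : L2 n} {u : ℝ → H1 n} (hu : IsSolution a b c h u₀ u₁ u)
    {R : ℝ} (hR : 0 ≤ R)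
    (hh : ∀ t : ℝ, 0 < t →
      ∀ᵐ x ∂(volume : Measure (E n)), x ∈ exterior n q R t → h t x = 0)
    (hu₀ : ∀ᵐ x ∂(volume : Measure (E n)), R < ‖x‖ → toL2 u₀ x = 0)
    (hu₁ : ∀ᵐ x ∂(volume : Measure (E n)), R < ‖x‖ → u₁ x = 0)
    {δ ε K : ℝ} (hδ : 0 < δ) (hε : 0 < ε) (hK : 0 ≤ K) {t : ℝ} (ht : 0 < t) :
    ∃ D, HasDerivAt (localEnergy b c q (q R + δ) ε K u₀ u) D t ∧
      D ≤ ∫ x, outerFlux b c q (q R + δ) ε K u₀ u t x := by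
  have hqc := hadm.contDiffOn.continuousOn
  obtain ⟨kc, kc', hkc, hkc2⟩ := exists_movingWeight hqc (q R + δ) hε hK hadm.contC
  obtain ⟨kb, kb', hkb, hkb2⟩ := exists_movingWeight hqc (q R + δ) hε hK hadm.contB
  have hd1 := hasDerivAt_weightedForm (hkc t) (hu.hasDerivAt_toL2 ht)
  have hd2 := hasDerivAt_weightedForm (hkb t)
    (hasDerivAt_gradIntegral hu.continuousOn hu.initial t)
  rw [extendPath_of_pos ht] at hd1 hd2
  have hE : localEnergy b c q (q R + δ) ε K u₀ u =ᶠ[𝓝 t] fun s =>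
      (∫ x, kc s x * ‖toL2 (extendPath u₀ u s) x‖ ^ 2) +
        ∫ x, kb s x * ‖gradIntegral u₀ u s x‖ ^ 2 := by
    filter_upwards [lt_mem_nhds ht] with s hs
    simp only [localEnergy, (hkc2 s hs.le _).1, (hkb2 s hs.le _).1]
  refine ⟨_, (hd1.add hd2).congr_of_eventuallyEq hE, ?_⟩
  set f := toL2 (u t) with hf
  set f' := timeDeriv u t with hf'
  set G := grad (u t) with hG
  set V := gradIntegral u₀ u t with hV
  set σ : E n → ℝ := cutoff q (q R + δ) ε K t with hσ
  have hqR : q 0 < t + (q R + δ) := by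
    have := hadm.strictMonoOn.monotoneOn (mem_Ici.2 le_rfl) hR hR
    linarith
  have hσ1 : ContDiff ℝ 1 σ := contDiff_cutoff hadm.contDiffOn hqR
  have hσ2 : HasCompactSupport σ := hasCompactSupport_cutoff q _ K t hε
  have hσ3 : tsupport σ ⊆ exterior n q R t := fun x hx =>
    radialStep_mem_exterior (t := t) hδ hqc (by
      rw [add_assoc]
      exact closure_mono (Function.support_mul_subset_left _ _) hx)
  have lc : LocallyL2 fun x => c x • f' x := MemLp.locallyL2_smul (Lp.memLp f') hadm.contC
  have la : LocallyL2 fun x => a x • f x := MemLp.locallyL2_smul (Lp.memLp f) hadm.contA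
  have lb : LocallyL2 fun x => b x • V x := MemLp.locallyL2_smul (Lp.memLp V) hadm.contB
  obtain ⟨ip, hp⟩ := pairing_sobolev (isOpen_exterior hqc R t) (lc.add la) lb (fun φ hφ hφt => by
    have h1 : ContDiff ℝ 1 φ := hφ.1.of_le (by simp)
    have h2 := hu.integrated_equation hadm.contA hadm.contB hadm.contC hadm.strictMonoOn hR hh hu₀
      hu₁ ht hφ hφt
    have ic : Integrable fun x => c x * f' x * φ x := lc.integrable_mul h1.continuous hφ.2
    have ia : Integrable fun x => a x * f x * φ x := la.integrable_mul h1.continuous hφ.2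
    have ib : Integrable fun x => b x * fderiv ℝ φ x (V x) :=
      (lb.integrable_fderiv_apply h1 hφ.2).congr (Eventually.of_forall fun x => by simp)
    have icb : Integrable fun x => c x * f' x * φ x + b x * fderiv ℝ φ x (V x) := ic.add ib
    rw [← h2, ← integral_add ic ib, ← integral_add icb ia]
    congr 1
    ext x
    simp only [smul_eq_mul, map_smul]
    ring) (hasWeakGradient_toL2 (u t)) (Lp.memLp _) (Lp.memLp _) hσ1 hσ2 hσ3
  have j1 := integrable_bcf_mul_norm_sq (kc' t) f
  have j2 := integrable_bcf_mul_inner (kc t) f f'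
  have j3 := integrable_bcf_mul_norm_sq (kb' t) V
  have j4 := integrable_bcf_mul_inner (kb t) V G
  have j5 : Integrable fun x => kc' t x * ‖f x‖ ^ 2 + 2 * (kc t x * inner ℝ (f x) (f' x)) :=
    j1.add (j2.const_mul 2)
  have j6 : Integrable fun x => kb' t x * ‖V x‖ ^ 2 + 2 * (kb t x * inner ℝ (V x) (G x)) :=
    j3.add (j4.const_mul 2)
  have j56 : Integrable fun x => (kc' t x * ‖f x‖ ^ 2 + 2 * (kc t x * inner ℝ (f x) (f' x))) +
      (kb' t x * ‖V x‖ ^ 2 + 2 * (kb t x * inner ℝ (V x) (G x))) := j5.add j6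
  -- Twice the tested identity, whose integral is zero, is subtracted under the integral, so that
  -- `f'` and `G` cancel pointwise.
  have hsum : ((∫ x, kc' t x * ‖f x‖ ^ 2) + 2 * ∫ x, kc t x * inner ℝ (f x) (f' x)) +
      ((∫ x, kb' t x * ‖V x‖ ^ 2) + 2 * ∫ x, kb t x * inner ℝ (V x) (G x)) =
      ∫ x, (((kc' t x * ‖f x‖ ^ 2 + 2 * (kc t x * inner ℝ (f x) (f' x))) +
        (kb' t x * ‖V x‖ ^ 2 + 2 * (kb t x * inner ℝ (V x) (G x)))) -
        2 * ((c x • f' x + a x • f x) * (σ x * f x) +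
          (σ x * inner ℝ (G x) (b x • V x) + f x * fderiv ℝ σ x (b x • V x)))) := by
    rw [integral_sub j56 (ip.const_mul 2), integral_const_mul 2, hp, integral_add j5 j6,
      integral_add j1 (j2.const_mul 2), integral_add j3 (j4.const_mul 2), integral_const_mul,
      integral_const_mul, mul_zero, sub_zero]
  refine hsum.le.trans (integral_mono
    (j56.sub (ip.const_mul 2))
    (integrable_outerFlux hadm _ K hε u₀ u t) fun x => ?_)
  have hdens := energy_density_le (f := f x) (K := K) (hadm.nonnegA x) (hadm.posB x)
    (cutoff_nonneg q (q R + δ) ε K t x)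
    (cutoffInner_nonneg q (q R + δ) ε K t x)
    (hadm.speed x)
    (ρ := ‖x‖ / (1 + ‖x‖ ^ 2)) (ε := ε) (o := cutoffOuter q (q R + δ) ε K t x)
    (by
      have := abs_fderiv_cutoff_le (K := K) hadm.contDiffOn hadm.deriv_pos hε hqR x (V x)
      rwa [mul_div_assoc] at this)
  rw [outerFlux]
  refine le_trans (le_of_eq ?_) hdens
  simp only [(hkc2 t ht.le x).1, (hkc2 t ht.le x).2, (hkb2 t ht.le x).1, (hkb2 t ht.le x).2,
    map_smul, real_inner_smul_right, smul_eq_mul, Real.norm_eq_abs, sq_abs]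
  have e1 : inner ℝ (f x) (f' x) = f' x * f x := rfl
  have e2 : inner ℝ (V x) (G x) = inner ℝ (G x) (V x) := real_inner_comm _ _
  rw [e1, e2, ← hσ]
  ring

theorem localEnergy_zero {b c : E n → ℝ} {q : ℝ → ℝ} (hq : StrictMonoOn q (Ici 0))
    {R : ℝ} (hR : 0 ≤ R) {δ ε K : ℝ} (hδ : 0 < δ) (u₀ : H1 n) (u : ℝ → H1 n)
    (hu₀ : ∀ᵐ x ∂(volume : Measure (E n)), R < ‖x‖ → toL2 u₀ x = 0) :
    localEnergy b c q (q R + δ) ε K u₀ u 0 = 0 := by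
  have h1 : ∫ x, c x * cutoff q (q R + δ) ε K 0 x * ‖toL2 (extendPath u₀ u 0) x‖ ^ 2 = 0 := by
    rw [extendPath_zero]
    refine integral_eq_zero_of_ae ?_
    filter_upwards [hu₀] with x hx
    by_cases hR' : R < ‖x‖
    · simp [hx hR']
    · have h2 : q ‖x‖ ≤ q R := hq.monotoneOn (norm_nonneg x) hR (not_lt.1 hR')
      have h3 : radialStep q (0 + (q R + δ)) x = 0 :=
        Real.smoothTransition.zero_of_nonpos (by linarith)
      rw [zero_add] at h3
      simp [cutoff, h3]
  have h2 : ∫ x, b x * cutoff q (q R + δ) ε K 0 x * ‖gradIntegral u₀ u 0 x‖ ^ 2 = 0 := by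
    rw [gradIntegral_zero]
    exact integral_eq_zero_of_ae (Eventually.of_forall fun x => by simp)
  rw [localEnergy, h1, h2, add_zero]

theorem localEnergy_le {a b c : E n → ℝ} {q : ℝ → ℝ} (hadm : Admissible a b c q)
    {h : ℝ → L2 n} {u₀ : H1 n} {u₁ : L2 n} {u : ℝ → H1 n} (hu : IsSolution a b c h u₀ u₁ u)
    {R : ℝ} (hR : 0 ≤ R)
    (hh : ∀ t : ℝ, 0 < t →
      ∀ᵐ x ∂(volume : Measure (E n)), x ∈ exterior n q R t → h t x = 0)
    (hu₀ : ∀ᵐ x ∂(volume : Measure (E n)), R < ‖x‖ → toL2 u₀ x = 0)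
    (hu₁ : ∀ᵐ x ∂(volume : Measure (E n)), R < ‖x‖ → u₁ x = 0)
    {δ ε K : ℝ} (hδ : 0 < δ) (hε : 0 < ε) (hK : 0 ≤ K) {T : ℝ} (hT : 0 < T) {B : ℝ}
    (hB : ∀ t, 0 < t → t < T → ∫ x, outerFlux b c q (q R + δ) ε K u₀ u t x ≤ B) :
    localEnergy b c q (q R + δ) ε K u₀ u T ≤ B * T := by
  have hqc := hadm.contDiffOn.continuousOn
  obtain ⟨kc, kc', hkc, hkc2⟩ := exists_movingWeight hqc (q R + δ) hε hK hadm.contC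
  obtain ⟨kb, kb', hkb, hkb2⟩ := exists_movingWeight hqc (q R + δ) hε hK hadm.contB
  -- Continuity is needed down to time `0`, where the initial value enters through `extendPath`; the
  -- derivative is needed only at positive times.
  have hcont : ContinuousOn (localEnergy b c q (q R + δ) ε K u₀ u) (Icc 0 T) := by
    have h1 : ContinuousOn (fun s => (∫ x, kc s x * ‖toL2 (extendPath u₀ u s) x‖ ^ 2) +
        ∫ x, kb s x * ‖gradIntegral u₀ u s x‖ ^ 2) (Icc 0 T) := fun s _ =>
      (continuousWithinAt_weightedForm (hkc s).continuousAt.continuousWithinAt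
        (continuous_toL2.comp
          (continuous_extendPath hu.continuousOn hu.initial)).continuousWithinAt).add
      (continuousWithinAt_weightedForm (hkb s).continuousAt.continuousWithinAt
        (hasDerivAt_gradIntegral hu.continuousOn hu.initial s).continuousAt.continuousWithinAt)
    refine h1.congr fun s hs => ?_
    simp only [localEnergy, (hkc2 s hs.1 _).1, (hkb2 s hs.1 _).1]
  have hderiv := fun t (ht : 0 < t) =>
    exists_hasDerivAt_localEnergy hadm hu hR hh hu₀ hu₁ hδ hε hK ht
  have key := (convex_Icc 0 T).image_sub_le_mul_sub_of_deriv_le hcont (C := B)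
    (fun t ht => by
      rw [interior_Icc] at ht
      obtain ⟨D, hD, -⟩ := hderiv t ht.1
      exact hD.differentiableAt.differentiableWithinAt)
    (fun t ht => by
      rw [interior_Icc] at ht
      obtain ⟨D, hD, hD'⟩ := hderiv t ht.1
      rw [hD.deriv]
      exact hD'.trans (hB t ht.1 ht.2))
    0 ⟨le_rfl, hT.le⟩ T ⟨hT.le, le_rfl⟩ hT.le
  rwa [localEnergy_zero hadm.strictMonoOn hR hδ u₀ u hu₀, sub_zero, sub_zero] at key

/-! ### Bounds on the outer flux -/

/-- Level sets of the outer step move inward with speed `K (1 + r²) / (2 r)`. The condition `hbK`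
says that this is at least the signal speed `√(b/c)`, so nothing enters from outside; algebraically
it is a completed square. -/
theorem outerFlux_nonpos {b c : E n → ℝ} {q : ℝ → ℝ} {A ε K : ℝ} (hε : 0 < ε) (hK : 0 < K)
    (hb : ∀ x, 0 < b x)
    (hbK : ∀ x, 4 * b x * (‖x‖ / (1 + ‖x‖ ^ 2)) ^ 2 ≤ K ^ 2 * c x)
    (u₀ : H1 n) (u : ℝ → H1 n) (t : ℝ) (x : E n) : outerFlux b c q A ε K u₀ u t x ≤ 0 := by
  have ho : 0 ≤ cutoffOuter q A ε K t x := mul_nonneg (radialStep_nonneg _ _ _) (stepDeriv_nonneg _)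
  refine mul_nonpos_of_nonneg_of_nonpos (mul_nonneg hε.le ho) ?_
  rw [sub_nonpos]
  set ρ := ‖x‖ / (1 + ‖x‖ ^ 2)
  set f := toL2 (u t) x
  set v := ‖gradIntegral u₀ u t x‖
  have h1 : 0 ≤ b x * (2 * ρ * |f| - K * v) ^ 2 := mul_nonneg (hb x).le (sq_nonneg _)
  have h2 : 4 * b x * ρ ^ 2 * |f| ^ 2 ≤ K ^ 2 * c x * f ^ 2 := by
    rw [sq_abs]
    exact mul_le_mul_of_nonneg_right (hbK x) (sq_nonneg f)
  have h3 : K * (4 * b x * (|f| * v) * ρ) ≤ K * (K * (c x * f ^ 2 + b x * v ^ 2)) := by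
    linarith [show b x * (2 * ρ * |f| - K * v) ^ 2 = 4 * b x * ρ ^ 2 * |f| ^ 2 -
      K * (4 * b x * (|f| * v) * ρ) + K ^ 2 * b x * v ^ 2 by ring]
  exact le_of_mul_le_mul_left h3 hK

theorem integral_weight_grad_le {b c : E n → ℝ} (hc : ∀ x, 0 ≤ c x)
    {u : ℝ → H1 n} {S : Set (E n)} (hS : MeasurableSet S) {t : ℝ} {M : ℝ≥0}
    (hE : energyOn b c u S t ≤ M) {k : E n → ℝ} (hk : Continuous k) (hk0 : ∀ x, 0 ≤ k x)
    (hkb : ∀ x, k x ≤ b x) (hkS : ∀ x, x ∉ S → k x = 0) :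
    ∫ x, k x * ‖grad (u t) x‖ ^ 2 ≤ M := by
  have hm : AEStronglyMeasurable (fun x => k x * ‖grad (u t) x‖ ^ 2) volume :=
    hk.aestronglyMeasurable.mul ((Lp.memLp (grad (u t))).1.norm.pow 2)
  rw [integral_eq_lintegral_of_nonneg_ae
    (Eventually.of_forall fun x => mul_nonneg (hk0 x) (sq_nonneg _)) hm]
  refine ENNReal.toReal_le_of_le_ofReal M.2 (le_trans ?_ (hE.trans (by simp)))
  rw [energyOn, ← lintegral_indicator hS]
  refine lintegral_mono fun x => ?_
  by_cases hx : x ∈ S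
  · rw [indicator_of_mem hx]
    refine ENNReal.ofReal_le_ofReal ?_
    have h1 := mul_le_mul_of_nonneg_right (hkb x) (sq_nonneg ‖grad (u t) x‖)
    have h2 := mul_nonneg (hc x) (sq_nonneg (timeDeriv u t x))
    linarith
  · simp [hkS x hx]

/-- Minkowski's inequality: multiplication by `√k` commutes with the time integral, whose integrand
then has `L²` norm at most `√M`. -/
theorem integral_weight_gradIntegral_le {u₀ : H1 n} {u : ℝ → H1 n} {t : ℝ} (ht : 0 ≤ t) {M : ℝ}
    {k : E n → ℝ} (hk : Continuous k) (hk' : HasCompactSupport k) (hk0 : ∀ x, 0 ≤ k x)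
    (hu : Continuous (extendPath u₀ u))
    (hM : ∀ s, 0 < s → s ≤ t → ∫ x, k x * ‖grad (u s) x‖ ^ 2 ≤ M) :
    ∫ x, k x * ‖gradIntegral u₀ u t x‖ ^ 2 ≤ t ^ 2 * M := by
  rcases ht.eq_or_lt with rfl | ht
  · rw [gradIntegral_zero]
    simp
  have hM0 : 0 ≤ M := (integral_nonneg fun x => mul_nonneg (hk0 x) (sq_nonneg _)).trans
    (hM t ht le_rfl)
  have hc : Continuous fun x => Real.sqrt (k x) := hk.sqrt
  obtain ⟨C, hC⟩ := (hk'.comp_left (g := Real.sqrt) Real.sqrt_zero).exists_bound_of_continuous hc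
  let κ : E n →ᵇ ℝ := .ofNormedAddCommGroup _ hc C hC
  have hκ : ∀ f : L2V n, ‖mulL2 κ f‖ ^ 2 = ∫ x, k x * ‖f x‖ ^ 2 := fun f => by
    rw [norm_mulL2_sq]
    congr 1
    ext x
    change Real.sqrt (k x) ^ 2 * _ = _
    rw [Real.sq_sqrt (hk0 x)]
  have hcont : Continuous fun s => grad (extendPath u₀ u s) := continuous_grad.comp hu
  have h1 : mulL2 κ (gradIntegral u₀ u t) =
      ∫ s in (0 : ℝ)..t, mulL2 κ (grad (extendPath u₀ u s)) :=
    ((mulL2 κ).intervalIntegral_comp_comm (hcont.intervalIntegrable 0 t)).symm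
  have h2 : ‖mulL2 κ (gradIntegral u₀ u t)‖ ≤ Real.sqrt M * |t - 0| := by
    rw [h1]
    refine intervalIntegral.norm_integral_le_of_norm_le_const fun s hs => ?_
    rw [uIoc_of_le ht.le] at hs
    refine Real.le_sqrt_of_sq_le ?_
    rw [hκ, extendPath_of_pos hs.1]
    exact hM s hs.1 hs.2
  rw [← hκ]
  rw [sub_zero, abs_of_pos ht] at h2
  calc _ ≤ (Real.sqrt M * t) ^ 2 := pow_le_pow_left₀ (norm_nonneg _) h2 2
    _ = t ^ 2 * M := by rw [mul_pow, Real.sq_sqrt hM0, mul_comm]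

/-- With `K = 0` the flux has an explicit factor `ε`. Young's inequality places the decay `‖x‖ / (1
+ ‖x‖²)` entirely on `u`, and the moving outer density is dominated by `C * logCutoff ε 3`. -/
theorem integral_outerFlux_le {a b c : E n → ℝ} {q : ℝ → ℝ} (hadm : Admissible a b c q)
    {A ε : ℝ} (hε : 0 < ε) {C : ℝ} (hC : ∀ s, ‖stepDeriv s‖ ≤ C) (u₀ : H1 n) (u : ℝ → H1 n)
    {t : ℝ} {M₁ M₂ : ℝ}
    (h1 : ∫ x, radialStep q (t + A) x * logCutoff ε 3 x * (b x * (‖x‖ / (1 + ‖x‖ ^ 2)) ^ 2) *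
      ‖toL2 (u t) x‖ ^ 2 ≤ M₁)
    (h2 : ∫ x, radialStep q (t + A) x * logCutoff ε 3 x * b x *
      ‖gradIntegral u₀ u t x‖ ^ 2 ≤ M₂) :
    ∫ x, outerFlux b c q A ε 0 u₀ u t x ≤ ε * (2 * C * (M₁ + M₂)) := by
  have hC0 : 0 ≤ C := (norm_nonneg _).trans (hC 0)
  have hr : Continuous (radialStep q (t + A) : E n → ℝ) :=
    Real.smoothTransition.continuous.comp
      ((continuous_comp_norm hadm.contDiffOn.continuousOn).sub continuous_const)
  have hl : Continuous (logCutoff ε 3 : E n → ℝ) := (contDiff_logCutoff ε 3 (m := 1)).continuous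
  have hls := hasCompactSupport_logCutoff (n := n) hε 3
  have hρ : Continuous fun x : E n => ‖x‖ / (1 + ‖x‖ ^ 2) :=
    continuous_norm.div (by fun_prop) fun x => (one_add_norm_sq_pos x).ne'
  have i1 : Integrable fun x => radialStep q (t + A) x * logCutoff ε 3 x *
      (b x * (‖x‖ / (1 + ‖x‖ ^ 2)) ^ 2) * ‖toL2 (u t) x‖ ^ 2 :=
    integrable_compact_mul_sq_norm ((hr.mul hl).mul (hadm.contB.mul (hρ.pow 2)))
      hls.mul_left.mul_right (Lp.memLp _)
  have i2 : Integrable fun x => radialStep q (t + A) x * logCutoff ε 3 x * b x *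
      ‖gradIntegral u₀ u t x‖ ^ 2 :=
    integrable_compact_mul_sq_norm ((hr.mul hl).mul hadm.contB)
      hls.mul_left.mul_right (Lp.memLp _)
  have key : ∫ x, outerFlux b c q A ε 0 u₀ u t x ≤
      ∫ x, (ε * (2 * C) * (radialStep q (t + A) x * logCutoff ε 3 x *
        (b x * (‖x‖ / (1 + ‖x‖ ^ 2)) ^ 2) * ‖toL2 (u t) x‖ ^ 2) +
        ε * (2 * C) * (radialStep q (t + A) x * logCutoff ε 3 x * b x *
      ‖gradIntegral u₀ u t x‖ ^ 2)) := by
    refine integral_mono (integrable_outerFlux hadm A 0 hε u₀ u t)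
      ((i1.const_mul _).add (i2.const_mul _)) fun x => ?_
    have hr0 := radialStep_nonneg q (t + A) x
    have hl0 := logCutoff_nonneg ε 3 x
    have hb0 := (hadm.posB x).le
    have hs0 := stepDeriv_nonneg (2 - ε * 0 * t - ε * Real.log (1 + ‖x‖ ^ 2))
    have hs : stepDeriv (2 - ε * 0 * t - ε * Real.log (1 + ‖x‖ ^ 2)) ≤ C * logCutoff ε 3 x := by
      rcases le_or_gt 0 (2 - ε * 0 * t - ε * Real.log (1 + ‖x‖ ^ 2)) with h | h
      · rw [logCutoff_eq_one (by linarith), mul_one]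
        exact (le_abs_self _).trans (hC _)
      · rw [stepDeriv_eq_zero_of_neg h]
        positivity
    simp only [outerFlux, cutoffOuter, zero_mul, sub_zero, Real.norm_eq_abs, sq_abs]
    set ρ := ‖x‖ / (1 + ‖x‖ ^ 2)
    have hρ0 : 0 ≤ ρ := by positivity
    set f := toL2 (u t) x
    set v := ‖gradIntegral u₀ u t x‖
    have e1 : 4 * b x * (|f| * v) * ρ ≤ 2 * (b x * ρ ^ 2 * f ^ 2 + b x * v ^ 2) := by
      have : 0 ≤ b x * (ρ * |f| - v) ^ 2 := by positivity
      have e3 : |f| ^ 2 = f ^ 2 := sq_abs f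
      linarith [show b x * (ρ * |f| - v) ^ 2 = b x * ρ ^ 2 * |f| ^ 2 - 2 * (b x * (|f| * v) * ρ) +
        b x * v ^ 2 by ring, congrArg (fun y => b x * ρ ^ 2 * y) e3]
    rw [mul_zero, zero_mul, sub_zero] at hs hs0
    simp only [mul_zero, zero_mul, sub_zero]
    have e2 : 0 ≤ b x * ρ ^ 2 * f ^ 2 + b x * v ^ 2 := by positivity
    calc _ ≤ ε * (radialStep q (t + A) x * stepDeriv (2 - ε * Real.log (1 + ‖x‖ ^ 2))) *
          (2 * (b x * ρ ^ 2 * f ^ 2 + b x * v ^ 2)) := by gcongr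
      _ ≤ ε * (radialStep q (t + A) x * (C * logCutoff ε 3 x)) *
          (2 * (b x * ρ ^ 2 * f ^ 2 + b x * v ^ 2)) := by gcongr
      _ = _ := by ring
  refine key.trans ?_
  rw [integral_add (i1.const_mul _) (i2.const_mul _), integral_const_mul, integral_const_mul]
  have : 0 ≤ ε * (2 * C) := by positivity
  nlinarith [mul_le_mul_of_nonneg_left h1 this, mul_le_mul_of_nonneg_left h2 this]

/-! ### Power weights and the conclusion -/

theorem sq_div_le (r : ℝ) (hr : 0 ≤ r) : (r / (1 + r ^ 2)) ^ 2 ≤ 4 / (1 + r) ^ 2 := by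
  have h : r / (1 + r ^ 2) ≤ 2 / (1 + r) := by
    rw [div_le_div_iff₀ (by positivity) (by positivity)]
    nlinarith [sq_nonneg (r - 1)]
  calc (r / (1 + r ^ 2)) ^ 2 ≤ (2 / (1 + r)) ^ 2 := pow_le_pow_left₀ (by positivity) h 2
    _ = _ := by rw [div_pow]; norm_num

theorem weight_mul_sq_div_le {b : E n → ℝ} {β b₁ : ℝ} (hb : ∀ x, b x ≤ b₁ * (1 + ‖x‖) ^ β)
    (hb₁ : 0 ≤ b₁) (x : E n) :
    b x * (‖x‖ / (1 + ‖x‖ ^ 2)) ^ 2 ≤ 4 * b₁ * (1 + ‖x‖) ^ (β - 2) := by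
  have h1 : 0 < 1 + ‖x‖ := by positivity
  have h2 : (1 + ‖x‖) ^ (β - 2) = (1 + ‖x‖) ^ β / (1 + ‖x‖) ^ 2 := by
    rw [Real.rpow_sub h1, Real.rpow_two]
  calc _ ≤ b₁ * (1 + ‖x‖) ^ β * (4 / (1 + ‖x‖) ^ 2) :=
        mul_le_mul (hb x) (sq_div_le _ (norm_nonneg x)) (sq_nonneg _) (by positivity)
    _ = _ := by rw [h2]; ring

theorem exp_mul_log_eq (s : ℝ) (x : E n) :
    Real.exp (s * Real.log (1 + ‖x‖ ^ 2)) = (1 + ‖x‖ ^ 2) ^ s := by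
  rw [Real.rpow_def_of_pos (one_add_norm_sq_pos x), mul_comm]

/-- The weight on `f²` is at most a multiple of `(1 + |x|)^(β - 2)`. For `β ≤ 2` it is bounded. For
`β > 2` Hardy's inequality with `s = (β - 2) / 2` applies, its gradient weight `(1 + |x|²)^(s + 1)`
being at most `(1 + |x|)^β`, hence controlled by `b`. The constant depends neither on `ε` nor on
`A`. -/
theorem exists_weighted_bound (hn : 1 ≤ n) {q : ℝ → ℝ} (hq : ContDiffOn ℝ 1 q (Ici 0))
    (hq' : ∀ r, 0 ≤ r → 0 < derivWithin q (Ici 0) r) {b : E n → ℝ} {β : ℝ} (hbc : Continuous b)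
    (hb : HasPowerGrowth b β) :
    ∃ C₂ : ℝ, 0 ≤ C₂ ∧ ∀ ε A : ℝ, 0 < ε → q 0 < A → ∀ (f : E n → ℝ) (G : E n → E n),
      HasWeakGradient f G → MemLp f 2 volume → MemLp G 2 volume → ∀ M : ℝ,
      (∀ k : E n → ℝ, Continuous k → (∀ x, 0 ≤ k x) → (∀ x, k x ≤ b x) →
        (∀ x, radialStep q A x = 0 → k x = 0) → ∫ x, k x * ‖G x‖ ^ 2 ≤ M) →
      ∫ x, radialStep q A x * logCutoff ε 3 x * (b x * (‖x‖ / (1 + ‖x‖ ^ 2)) ^ 2) * ‖f x‖ ^ 2 ≤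
        C₂ * ((∫ x, ‖f x‖ ^ 2) + M) := by
  obtain ⟨b₀, b₁, hb₀, hb₁, hbb⟩ := hb
  obtain ⟨C, hC⟩ := exists_stepDeriv_le
  have hC0 : 0 ≤ C := (norm_nonneg _).trans (hC 0)
  have hbup := weight_mul_sq_div_le (fun x => (hbb x).2) hb₁.le
  have hρ : Continuous fun x : E n => ‖x‖ / (1 + ‖x‖ ^ 2) :=
    continuous_norm.div (by fun_prop) fun x => (one_add_norm_sq_pos x).ne'
  have hint : ∀ ε A : ℝ, 0 < ε → ∀ (f : E n → ℝ), MemLp f 2 volume →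
      Integrable fun x => radialStep q A x * logCutoff ε 3 x *
        (b x * (‖x‖ / (1 + ‖x‖ ^ 2)) ^ 2) * ‖f x‖ ^ 2 := fun ε A hε f hf =>
    integrable_compact_mul_sq_norm
      (((Real.smoothTransition.continuous.comp
      ((continuous_comp_norm hq.continuousOn).sub continuous_const)).mul
      (contDiff_logCutoff ε 3 (m := 1)).continuous).mul (hbc.mul (hρ.pow 2)))
      (hasCompactSupport_logCutoff hε 3).mul_left.mul_right hf
  rcases le_or_gt β 2 with hβ | hβ
  · refine ⟨4 * b₁, by positivity, fun ε A hε hA f G hfG hf hG M hM => ?_⟩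
    have hM0 : 0 ≤ M := by
      have := hM (fun _ => 0) continuous_const (fun _ => le_rfl) (fun x =>
        (by have := (hbb x).1; positivity : 0 ≤ b₀ * (1 + ‖x‖) ^ β).trans (hbb x).1) fun _ _ => rfl
      simpa using this
    have h1 : ∫ x, radialStep q A x * logCutoff ε 3 x * (b x * (‖x‖ / (1 + ‖x‖ ^ 2)) ^ 2) *
        ‖f x‖ ^ 2 ≤ ∫ x, 4 * b₁ * ‖f x‖ ^ 2 := by
      refine integral_mono (hint ε A hε f hf)
        ((hf.integrable_norm_pow (by norm_num)).const_mul _) fun x => ?_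
      refine mul_le_mul_of_nonneg_right ?_ (sq_nonneg _)
      have h2 : (1 + ‖x‖) ^ (β - 2) ≤ 1 :=
        Real.rpow_le_one_of_one_le_of_nonpos (by linarith [norm_nonneg x]) (by linarith)
      have h3 : b x * (‖x‖ / (1 + ‖x‖ ^ 2)) ^ 2 ≤ 4 * b₁ :=
        (hbup x).trans (mul_le_of_le_one_right (by positivity) h2)
      have h4 := radialStep_nonneg q A x
      have h5 := logCutoff_nonneg ε 3 x
      have h6 : radialStep q A x * logCutoff ε 3 x ≤ 1 :=
        mul_le_one₀ (radialStep_le_one q A x) h5 (logCutoff_le_one ε 3 x)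
      calc _ ≤ radialStep q A x * logCutoff ε 3 x * (4 * b₁) :=
            mul_le_mul_of_nonneg_left h3 (mul_nonneg h4 h5)
        _ ≤ 1 * (4 * b₁) := by gcongr
        _ = _ := one_mul _
    rw [integral_const_mul] at h1
    have : 0 ≤ 4 * b₁ * M := by positivity
    linarith
  · set s := (β - 2) / 2 with hs
    have hs0 : 0 ≤ s := by rw [hs]; linarith
    refine ⟨8 * b₁ * 2 ^ s * (4 * C + 4 / b₀), by positivity,
      fun ε A hε hA f G hfG hf hG M hM => ?_⟩
    have hM0 : 0 ≤ M := by
      have := hM (fun _ => 0) continuous_const (fun _ => le_rfl) (fun x =>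
        (by have := (hbb x).1; positivity : 0 ≤ b₀ * (1 + ‖x‖) ^ β).trans (hbb x).1) fun _ _ => rfl
      simpa using this
    -- On the support of `logCutoff ε 3` one has `log (1 + |x|²) ≤ 3 / ε`. The first bound on `η`
    -- makes `logCutoff η 2` equal to one there, and the second makes the truncated weight at least
    -- half of the full one.
    set η := min (ε / 3) (Real.exp (-(s * (3 / ε)))) with hη
    have hη0 : 0 < η := lt_min (by positivity) (Real.exp_pos _)
    have hardy := hardy_truncated hn hq hq' hA hC hs0 hη0 hfG hf hG
    have hrc : Continuous (radialStep q A : E n → ℝ) := (contDiff_radialStep hq hA).continuous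
    have hlc : Continuous (logCutoff η 2 : E n → ℝ) := (contDiff_logCutoff η 2 (m := 1)).continuous
    have hec : Continuous fun x : E n => Real.exp ((s + 1) * Real.log (1 + ‖x‖ ^ 2)) :=
      (continuous_const.mul (contDiff_log_one_add_norm_sq (m := 1)).continuous).rexp
    have hgrad : ∫ x, radialStep q A x * logCutoff η 2 x *
        Real.exp ((s + 1) * Real.log (1 + ‖x‖ ^ 2)) * ‖G x‖ ^ 2 ≤ M / b₀ := by
      have := hM (fun x => b₀ * (radialStep q A x * logCutoff η 2 x *
        Real.exp ((s + 1) * Real.log (1 + ‖x‖ ^ 2))))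
        (continuous_const.mul ((hrc.mul hlc).mul hec))
        (fun x => by
          have h4 := radialStep_nonneg q A x
          have h5 := logCutoff_nonneg η 2 x
          positivity)
        (fun x => by
          refine le_trans (mul_le_mul_of_nonneg_left ?_ hb₀.le) (hbb x).1
          have h5 := logCutoff_nonneg η 2 x
          have h6 : radialStep q A x * logCutoff η 2 x ≤ 1 :=
            mul_le_one₀ (radialStep_le_one q A x) h5 (logCutoff_le_one η 2 x)
          calc _ ≤ 1 * Real.exp ((s + 1) * Real.log (1 + ‖x‖ ^ 2)) := by gcongr
            _ = (1 + ‖x‖ ^ 2) ^ (s + 1) := by rw [one_mul, exp_mul_log_eq]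
            _ ≤ ((1 + ‖x‖) ^ 2) ^ (s + 1) := by
              refine Real.rpow_le_rpow (by positivity) ?_ (by linarith)
              nlinarith [norm_nonneg x]
            _ = (1 + ‖x‖) ^ β := by
              rw [← Real.rpow_natCast, ← Real.rpow_mul (by positivity)]
              congr 1
              rw [hs]
              push_cast
              ring)
        (fun x hx => by simp [hx])
      rw [le_div_iff₀ hb₀, mul_comm, ← integral_const_mul]
      simpa only [mul_assoc] using this
    have hY : Continuous fun x : E n =>
        radialStep q A x * (logCutoff η 2 x * truncWeight η s x) :=
      hrc.mul (hlc.mul (contDiff_truncWeight hη0 s).continuous)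
    have i2 : Integrable fun x =>
        radialStep q A x * (logCutoff η 2 x * truncWeight η s x) * ‖f x‖ ^ 2 :=
      integrable_compact_mul_sq_norm hY (hasCompactSupport_logCutoff hη0 2).mul_right.mul_left hf
    have h1 : ∫ x, radialStep q A x * logCutoff ε 3 x * (b x * (‖x‖ / (1 + ‖x‖ ^ 2)) ^ 2) *
        ‖f x‖ ^ 2 ≤ ∫ x, 8 * b₁ * 2 ^ s *
          (radialStep q A x * (logCutoff η 2 x * truncWeight η s x) * ‖f x‖ ^ 2) := by
      refine integral_mono (hint ε A hε f hf) (i2.const_mul _) fun x => ?_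
      have h4 := radialStep_nonneg q A x
      have h5 := logCutoff_nonneg ε 3 x
      by_cases hx : logCutoff ε 3 x = 0
      · simp only [hx, mul_zero, zero_mul]
        have h6 := logCutoff_nonneg η 2 x
        have h7 := (truncWeight_pos hη0 s x).le
        positivity
      have hlog := log_lt_of_logCutoff_ne_zero hx
      have hlog0 := log_one_add_norm_sq_nonneg x
      have hη1 : logCutoff η 2 x = 1 := by
        refine logCutoff_eq_one ?_
        have : η * Real.log (1 + ‖x‖ ^ 2) ≤ ε / 3 * Real.log (1 + ‖x‖ ^ 2) :=
          mul_le_mul_of_nonneg_right (min_le_left _ _) hlog0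
        linarith
      have hη2 : η ≤ Real.exp (-(s * Real.log (1 + ‖x‖ ^ 2))) := by
        refine (min_le_right _ _).trans (Real.exp_le_exp.2 (neg_le_neg ?_))
        refine mul_le_mul_of_nonneg_left ?_ hs0
        rw [le_div_iff₀ hε]
        linarith
      have hw := exp_le_two_mul_truncWeight hη0 hη2
      have hpow : (1 + ‖x‖) ^ (β - 2) ≤ 2 ^ s * Real.exp (s * Real.log (1 + ‖x‖ ^ 2)) := by
        rw [exp_mul_log_eq, ← Real.mul_rpow (by norm_num) (by positivity)]
        calc (1 + ‖x‖) ^ (β - 2) = ((1 + ‖x‖) ^ 2) ^ s := by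
              rw [← Real.rpow_natCast, ← Real.rpow_mul (by positivity)]
              congr 1
              rw [hs]
              push_cast
              ring
          _ ≤ _ := by
              refine Real.rpow_le_rpow (by positivity) ?_ hs0
              nlinarith [sq_nonneg (‖x‖ - 1)]
      have hbx : b x * (‖x‖ / (1 + ‖x‖ ^ 2)) ^ 2 ≤ 8 * b₁ * 2 ^ s * truncWeight η s x := by
        calc _ ≤ 4 * b₁ * (1 + ‖x‖) ^ (β - 2) := hbup x
          _ ≤ 4 * b₁ * (2 ^ s * (2 * truncWeight η s x)) := by
            refine mul_le_mul_of_nonneg_left (hpow.trans ?_) (by positivity)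
            exact mul_le_mul_of_nonneg_left hw (by positivity)
          _ = _ := by ring
      rw [hη1]
      have h7 := (truncWeight_pos hη0 s x).le
      calc _ ≤ radialStep q A x * 1 * (8 * b₁ * 2 ^ s * truncWeight η s x) * ‖f x‖ ^ 2 := by
            refine mul_le_mul_of_nonneg_right ?_ (sq_nonneg _)
            have := logCutoff_le_one ε 3 x
            calc _ ≤ radialStep q A x * logCutoff ε 3 x * (8 * b₁ * 2 ^ s * truncWeight η s x) :=
                  mul_le_mul_of_nonneg_left hbx (mul_nonneg h4 h5)
              _ ≤ _ := by gcongr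
        _ = _ := by ring
    rw [integral_const_mul] at h1
    refine h1.trans ?_
    rw [mul_assoc (8 * b₁ * 2 ^ s)]
    refine mul_le_mul_of_nonneg_left (hardy.trans ?_) (by positivity)
    have hf0 : 0 ≤ ∫ x, ‖f x‖ ^ 2 := integral_nonneg fun x => sq_nonneg _
    have e1 : 0 ≤ 4 / b₀ * ∫ x, ‖f x‖ ^ 2 := by positivity
    have e2 : 0 ≤ 4 * C * M := by positivity
    have e3 : 4 * (M / b₀) = 4 / b₀ * M := by ring
    nlinarith

/-- For small `ε` the energy dominates `∫ c u²` against a fixed outer cutoff; letting `ε → 0` kills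
this integral, and the fixed cutoffs of scale `1 / (N + 1)` exhaust space. -/
theorem ae_eq_zero_of_localEnergy_le {a b c : E n → ℝ} {q : ℝ → ℝ} (hadm : Admissible a b c q)
    {A K B : ℝ} (hK : 0 ≤ K) {u₀ : H1 n} {u : ℝ → H1 n} {T : ℝ} (hT : 0 < T)
    (hle : ∀ ε, 0 < ε → localEnergy b c q A ε K u₀ u T ≤ ε * B) :
    ∀ᵐ x ∂(volume : Measure (E n)), T + A < q ‖x‖ → toL2 (u T) x = 0 := by
  have hrc : Continuous (radialStep q (T + A) : E n → ℝ) :=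
    Real.smoothTransition.continuous.comp
      ((continuous_comp_norm hadm.contDiffOn.continuousOn).sub continuous_const)
  have hae : ∀ N : ℕ, ∀ᵐ x ∂(volume : Measure (E n)),
      c x * (radialStep q (T + A) x * logCutoff (1 / ((N : ℝ) + 1)) 1 x) *
        ‖toL2 (u T) x‖ ^ 2 = 0 := by
    intro N
    have hN : (0 : ℝ) < 1 / ((N : ℝ) + 1) := by positivity
    have i1 : Integrable fun x => c x * (radialStep q (T + A) x *
        logCutoff (1 / ((N : ℝ) + 1)) 1 x) * ‖toL2 (u T) x‖ ^ 2 :=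
      integrable_compact_mul_sq_norm (hadm.contC.mul (hrc.mul
        (contDiff_logCutoff _ 1 (m := 1)).continuous))
        (hasCompactSupport_logCutoff hN 1).mul_left.mul_left (Lp.memLp _)
    have h0 : ∀ x, 0 ≤ c x * (radialStep q (T + A) x *
        logCutoff (1 / ((N : ℝ) + 1)) 1 x) * ‖toL2 (u T) x‖ ^ 2 := fun x =>
      mul_nonneg (mul_nonneg (hadm.posC x).le (mul_nonneg (radialStep_nonneg _ _ _)
        (logCutoff_nonneg _ _ _))) (sq_nonneg _)
    -- Where the fixed cutoff is nonzero, `log (1 + |x|²) < N + 1`. This range of `ε` gives `ε (log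
    -- (1 + |x|²) + K T) ≤ 1`, so the moving outer cutoff is one there.
    have hbound : ∀ ε, 0 < ε → ε ≤ 1 / ((N : ℝ) + 1 + K * T) →
        ∫ x, c x * (radialStep q (T + A) x * logCutoff (1 / ((N : ℝ) + 1)) 1 x) *
          ‖toL2 (u T) x‖ ^ 2 ≤ ε * B := by
      intro ε hε hεN
      refine le_trans ?_ (hle ε hε)
      rw [localEnergy, extendPath_of_pos hT]
      have i2 : Integrable fun x => c x * cutoff q A ε K T x * ‖toL2 (u T) x‖ ^ 2 :=
        integrable_compact_mul_sq_norm (hadm.contC.mul (hrc.mul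
          (contDiff_logCutoff _ _ (m := 1)).continuous))
          (hasCompactSupport_cutoff q A K T hε).mul_left (Lp.memLp _)
      have h2 : 0 ≤ ∫ x, b x * cutoff q A ε K T x * ‖gradIntegral u₀ u T x‖ ^ 2 :=
        integral_nonneg fun x => mul_nonneg (mul_nonneg (hadm.posB x).le
          (cutoff_nonneg _ _ _ _ _ _)) (sq_nonneg _)
      refine le_trans (integral_mono i1 i2 fun x => ?_) (le_add_of_nonneg_right h2)
      refine mul_le_mul_of_nonneg_right (mul_le_mul_of_nonneg_left
        (mul_le_mul_of_nonneg_left ?_ (radialStep_nonneg _ _ _)) (hadm.posC x).le) (sq_nonneg _)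
      by_cases hx : logCutoff (1 / ((N : ℝ) + 1)) 1 x = 0
      · rw [hx]
        exact logCutoff_nonneg _ _ _
      · have hlog := log_lt_of_logCutoff_ne_zero hx
        rw [one_div, inv_mul_lt_iff₀ (by positivity), mul_one] at hlog
        have hKT : 0 ≤ K * T := by positivity
        rw [le_div_iff₀ (by positivity)] at hεN
        have hεlog := mul_lt_mul_of_pos_left hlog hε
        rw [logCutoff_eq_one (ε := ε) (a := 2 - ε * K * T) (by nlinarith)]
        exact logCutoff_le_one _ _ _
    have hint : ∫ x, c x * (radialStep q (T + A) x * logCutoff (1 / ((N : ℝ) + 1)) 1 x) *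
        ‖toL2 (u T) x‖ ^ 2 = 0 := by
      refine le_antisymm ?_ (integral_nonneg h0)
      have hlim : Tendsto (fun ε : ℝ => ε * B) (𝓝[>] 0) (𝓝 0) := by
        have : Tendsto (fun ε : ℝ => ε * B) (𝓝 0) (𝓝 (0 * B)) := tendsto_id.mul_const B
        rw [zero_mul] at this
        exact this.mono_left nhdsWithin_le_nhds
      refine ge_of_tendsto hlim ?_
      filter_upwards [Ioc_mem_nhdsGT (show (0 : ℝ) < 1 / ((N : ℝ) + 1 + K * T) by positivity)]
        with ε hε using hbound ε hε.1 hε.2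
    exact (integral_eq_zero_iff_of_nonneg h0 i1).1 hint
  filter_upwards [ae_all_iff.2 hae] with x hx hqx
  obtain ⟨N, hN⟩ := exists_nat_gt (Real.log (1 + ‖x‖ ^ 2))
  have h1 : 0 < radialStep q (T + A) x := Real.smoothTransition.pos_of_pos (by linarith)
  have h2 : 0 < logCutoff (1 / ((N : ℝ) + 1)) 1 x := by
    refine Real.smoothTransition.pos_of_pos ?_
    rw [sub_pos, one_div, inv_mul_lt_iff₀ (by positivity)]
    linarith
  have h3 := mul_pos (hadm.posC x) (mul_pos h1 h2)
  rcases mul_eq_zero.1 (hx N) with h | h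
  · exact absurd h h3.ne'
  · simpa using h

/-- The exponent condition reads `β - 2 ≤ -γ`: after the gain of two powers from the logarithmic
cutoff, `b` is dominated by `c`. -/
theorem exists_outerFlux_bound_of_le {a b c : E n → ℝ} {q : ℝ → ℝ} (hadm : Admissible a b c q)
    {β γ : ℝ} (hb : HasPowerGrowth b β) (hc : HasPowerGrowth c (-γ)) (hβγ : β + γ ≤ 2)
    (A : ℝ) (u₀ : H1 n) (u : ℝ → H1 n) :
    ∃ K : ℝ, 0 ≤ K ∧ ∀ ε t, 0 < ε → ∫ x, outerFlux b c q A ε K u₀ u t x ≤ 0 := by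
  obtain ⟨b₀, b₁, hb₀, hb₁, hbb⟩ := hb
  obtain ⟨c₀, c₁, hc₀, hc₁, hcc⟩ := hc
  -- The requirement is `K² ≥ 16 b₁ / c₀`; since `(1 + y)² ≥ y` for `y ≥ 0`, this choice avoids a
  -- square root.
  have hK : 0 < 1 + 16 * b₁ / c₀ := by positivity
  refine ⟨1 + 16 * b₁ / c₀, hK.le, fun ε t hε => integral_nonpos fun x =>
    outerFlux_nonpos hε hK hadm.posB (fun x => ?_) u₀ u t x⟩
  have h1 := weight_mul_sq_div_le (fun x => (hbb x).2) hb₁.le x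
  have h2 : (1 + ‖x‖) ^ (β - 2) ≤ (1 + ‖x‖) ^ (-γ) :=
    Real.rpow_le_rpow_of_exponent_le (by linarith [norm_nonneg x]) (by linarith)
  have h3 : 16 * b₁ / c₀ ≤ (1 + 16 * b₁ / c₀) ^ 2 := by
    have : 0 ≤ 16 * b₁ / c₀ := by positivity
    nlinarith
  calc 4 * b x * (‖x‖ / (1 + ‖x‖ ^ 2)) ^ 2 = 4 * (b x * (‖x‖ / (1 + ‖x‖ ^ 2)) ^ 2) := by ring
    _ ≤ 4 * (4 * b₁ * (1 + ‖x‖) ^ (-γ)) := by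
      refine mul_le_mul_of_nonneg_left (h1.trans ?_) (by norm_num)
      exact mul_le_mul_of_nonneg_left h2 (by positivity)
    _ = 16 * b₁ / c₀ * (c₀ * (1 + ‖x‖) ^ (-γ)) := by field_simp; ring
    _ ≤ (1 + 16 * b₁ / c₀) ^ 2 * c x :=
      mul_le_mul h3 (hcc x).1 (by positivity) (by positivity)

/-- Here `L` bounds `‖u(t)‖²` on `[0, T]` by compactness, which uses the initial limit. Hardy's
inequality handles the part of the flux with `u`, and Minkowski's inequality, with constant `T² M`,
the part with `V`. -/
theorem exists_outerFlux_bound_of_energy (hn : 1 ≤ n) {a b c : E n → ℝ} {q : ℝ → ℝ}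
    (hadm : Admissible a b c q) {β : ℝ} (hb : HasPowerGrowth b β)
    {u₀ : H1 n} {u : ℝ → H1 n} (hu : Continuous (extendPath u₀ u)) {R δ T : ℝ} (hR : 0 ≤ R)
    (hδ : 0 < δ) {M : ℝ≥0}
    (hE : ∀ t ∈ Ioc (0 : ℝ) T, energyOn b c u (exterior n q R t) t ≤ M) :
    ∃ B : ℝ, ∀ ε t, 0 < ε → 0 < t → t < T →
      ∫ x, outerFlux b c q (q R + δ) ε 0 u₀ u t x ≤ ε * B := by
  have hqc := hadm.contDiffOn.continuousOn
  obtain ⟨C, hC⟩ := exists_stepDeriv_le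
  have hC0 : 0 ≤ C := (norm_nonneg _).trans (hC 0)
  obtain ⟨C₂, hC₂, hweight⟩ := exists_weighted_bound hn hadm.contDiffOn hadm.deriv_pos hadm.contB hb
  have hcn : Continuous fun t => ‖toL2 (extendPath u₀ u t)‖ ^ 2 := (continuous_toL2.comp hu).norm.pow 2
  obtain ⟨L, hL⟩ := (isCompact_Icc (a := (0 : ℝ)) (b := T)).exists_bound_of_continuousOn
    hcn.continuousOn
  -- A weight living in the exterior region at time `t` also lives in the larger regions at earlier
  -- times `s`, so the energy bounds at all those times control it.
  have hgrad : ∀ s t, 0 < s → s ≤ t → t ≤ T → ∀ k : E n → ℝ, Continuous k → (∀ x, 0 ≤ k x) →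
      (∀ x, k x ≤ b x) → (∀ x, radialStep q (t + (q R + δ)) x = 0 → k x = 0) →
      ∫ x, k x * ‖grad (u s) x‖ ^ 2 ≤ M := by
    intro s t hs hst htT k hk hk0 hkb hkr
    refine integral_weight_grad_le (fun x => (hadm.posC x).le)
      (isOpen_exterior hqc R s).measurableSet (hE s ⟨hs, hst.trans htT⟩) hk hk0 hkb fun x hx => ?_
    refine hkr x (Real.smoothTransition.zero_of_nonpos ?_)
    simp only [exterior, mem_ofPred_eq, not_lt] at hx
    linarith
  refine ⟨2 * C * (C₂ * (L + M) + T ^ 2 * M), fun ε t hε ht htT => ?_⟩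
  have hqR : q 0 < t + (q R + δ) := by
    have := hadm.strictMonoOn.monotoneOn (mem_Ici.2 le_rfl) hR hR
    linarith
  refine integral_outerFlux_le hadm hε hC u₀ u ?_ ?_
  · refine (hweight ε _ hε hqR _ _ (hasWeakGradient_toL2 (u t)) (Lp.memLp _) (Lp.memLp _) M
      (hgrad t t ht le_rfl htT.le)).trans (mul_le_mul_of_nonneg_left ?_ hC₂)
    have h1 : ∫ x, ‖toL2 (u t) x‖ ^ 2 = ‖toL2 (u t)‖ ^ 2 := by
      rw [← real_inner_self_eq_norm_sq, L2.inner_def]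
      simp only [real_inner_self_eq_norm_sq]
    have h2 := (le_abs_self _).trans (hL t ⟨ht.le, htT.le⟩)
    rw [extendPath_of_pos ht] at h2
    linarith
  · have hr0 := fun x : E n => radialStep_nonneg q (t + (q R + δ)) x
    have hl0 := fun x : E n => logCutoff_nonneg ε 3 x
    have hk : Continuous fun x : E n => radialStep q (t + (q R + δ)) x * logCutoff ε 3 x * b x :=
      (((contDiff_radialStep hadm.contDiffOn hqR).continuous).mul
        (contDiff_logCutoff ε 3 (m := 1)).continuous).mul hadm.contB
    have hk0 : ∀ x, 0 ≤ radialStep q (t + (q R + δ)) x * logCutoff ε 3 x * b x := fun x =>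
      mul_nonneg (mul_nonneg (hr0 x) (hl0 x)) (hadm.posB x).le
    refine (integral_weight_gradIntegral_le ht.le hk
      (hasCompactSupport_logCutoff hε 3).mul_left.mul_right hk0 hu (M := M)
      fun s hs hst => hgrad s t hs hst htT.le _ hk hk0 (fun x => ?_) fun x hx => ?_).trans ?_
    · exact mul_le_of_le_one_left (hadm.posB x).le
        (mul_le_one₀ (radialStep_le_one _ _ _) (hl0 x) (logCutoff_le_one _ _ _))
    · rw [hx, zero_mul, zero_mul]
    · exact mul_le_mul_of_nonneg_right (pow_le_pow_left₀ ht.le htT.le 2) M.2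

theorem HasPowerGrowth.pos {f : E n → ℝ} {κ : ℝ} (hf : HasPowerGrowth f κ) (x : E n) :
    0 < f x := by
  obtain ⟨f₀, f₁, h₀, h₁, h⟩ := hf
  exact lt_of_lt_of_le (by positivity) (h x).1

theorem admissible_of_hasPowerGrowth (hn : 1 ≤ n) {a b c : E n → ℝ} {α β γ : ℝ}
    (ha : Continuous a) (hb : Continuous b) (hc : Continuous c)
    (ha' : HasPowerGrowth a α) (hb' : HasPowerGrowth b β) (hc' : HasPowerGrowth c γ)
    {q : ℝ → ℝ} (hq : ContDiffOn ℝ 1 q (Ici 0))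
    (hq' : ∀ x : E n, 0 < derivWithin q (Ici 0) ‖x‖ ∧
      derivWithin q (Ici 0) ‖x‖ ≤ Real.sqrt (c x / b x)) : Admissible a b c q where
  contA := ha
  contB := hb
  contC := hc
  nonnegA x := (ha'.pos x).le
  posB := hb'.pos
  posC := hc'.pos
  contDiffOn := hq
  deriv_pos r hr := by
    -- Every `r ≥ 0` is the norm of some vector because `n ≥ 1`.
    have := (hq' (EuclideanSpace.single ⟨0, hn⟩ r)).1
    rwa [PiLp.norm_single, Real.norm_of_nonneg hr] at this
  speed x := by
    have h1 : derivWithin q (Ici 0) ‖x‖ ^ 2 ≤ c x / b x := by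
      rw [← Real.sq_sqrt (div_pos (hc'.pos x) (hb'.pos x)).le]
      exact pow_le_pow_left₀ (hq' x).1.le (hq' x).2 2
    rwa [le_div_iff₀ (hb'.pos x), mul_comm] at h1

end DampedWave

end

theorem propositionA1
    (n : ℕ) (hn : 1 ≤ n)
    (a b c : DampedWave.E n → ℝ) (α β γ : ℝ)
    (ha : ContDiff ℝ ∞ a) (hb : ContDiff ℝ ∞ b) (hc : ContDiff ℝ ∞ c)
    (ha' : DampedWave.HasPowerGrowth a (-α))
    (hb' : DampedWave.HasPowerGrowth b β)
    (hc' : DampedWave.HasPowerGrowth c (-γ))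
    (q : ℝ → ℝ) (hq : ContDiffOn ℝ 1 q (Ici 0))
    (hq' : ∀ x : DampedWave.E n, 0 < derivWithin q (Ici 0) ‖x‖ ∧
      derivWithin q (Ici 0) ‖x‖ ≤ Real.sqrt (c x / b x))
    (R : ℝ) (hR : 0 ≤ R)
    (h : ℝ → DampedWave.L2 n) (hh : ContinuousOn h (Ioi 0))
    (hh' : ∀ t : ℝ, 0 < t →
      ∀ᵐ x ∂(volume : Measure (DampedWave.E n)), x ∈ DampedWave.exterior n q R t → h t x = 0)
    (u₀ : DampedWave.H1 n) (u₁ : DampedWave.L2 n)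
    (u : ℝ → DampedWave.H1 n) (hu : DampedWave.IsSolution a b c h u₀ u₁ u)
    -- If `β + γ ≤ 2` nothing more is assumed. If `β + γ > 2`, waves can reach infinity in finite
    -- time, and a solution is understood to have locally bounded energy in the exterior region.
    (hE : 2 < β + γ → ∀ T : ℝ, ∃ M : ℝ≥0, ∀ t ∈ Ioc (0 : ℝ) T,
      DampedWave.energyOn b c u (DampedWave.exterior n q R t) t ≤ M)
    (hu₀ : ∀ᵐ x ∂(volume : Measure (DampedWave.E n)), R < ‖x‖ → DampedWave.toL2 u₀ x = 0)
    (hu₁ : ∀ᵐ x ∂(volume : Measure (DampedWave.E n)), R < ‖x‖ → u₁ x = 0) :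
    ∀ t : ℝ, 0 < t →
      ∀ᵐ x ∂(volume : Measure (DampedWave.E n)),
        x ∈ DampedWave.exterior n q R t → DampedWave.toL2 (u t) x = 0 := by
  intro T hT
  have hadm := DampedWave.admissible_of_hasPowerGrowth hn ha.continuous hb.continuous
    hc.continuous ha' hb' hc' hq hq'
  have key : ∀ δ, 0 < δ → ∀ᵐ x ∂(volume : Measure (DampedWave.E n)),
      T + (q R + δ) < q ‖x‖ → DampedWave.toL2 (u T) x = 0 := by
    intro δ hδ
    rcases le_or_gt (β + γ) 2 with hβγ | hβγ
    · obtain ⟨K, hK, hflux⟩ :=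
        DampedWave.exists_outerFlux_bound_of_le hadm hb' hc' hβγ (q R + δ) u₀ u
      refine DampedWave.ae_eq_zero_of_localEnergy_le (u₀ := u₀) (B := 0) hadm hK hT fun ε hε => ?_
      have := DampedWave.localEnergy_le hadm hu hR hh' hu₀ hu₁ hδ hε hK hT
        fun t _ _ => hflux ε t hε
      simpa using this
    · obtain ⟨M, hM⟩ := hE hβγ T
      obtain ⟨B, hB⟩ := DampedWave.exists_outerFlux_bound_of_energy hn hadm hb'
        (DampedWave.continuous_extendPath hu.continuousOn hu.initial) hR hδ hM
      refine DampedWave.ae_eq_zero_of_localEnergy_le (u₀ := u₀) (B := B * T) hadm le_rfl hT fun ε hε => ?_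
      have := DampedWave.localEnergy_le hadm hu hR hh' hu₀ hu₁ hδ hε le_rfl hT
        fun t ht htT => hB ε t hε ht htT
      rwa [mul_assoc] at this
  -- Restricting `δ` to the values `1 / (N + 1)` leaves countably many null sets to discard.
  have hall : ∀ᵐ x ∂(volume : Measure (DampedWave.E n)), ∀ N : ℕ,
      T + (q R + 1 / ((N : ℝ) + 1)) < q ‖x‖ → DampedWave.toL2 (u T) x = 0 :=
    ae_all_iff.2 fun N => key _ (by positivity)
  filter_upwards [hall] with x hx hxe
  have hpos : 0 < q ‖x‖ - (T + q R) := sub_pos.2 hxe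
  obtain ⟨N, hN⟩ := exists_nat_one_div_lt hpos
  exact hx N (by linarith)
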